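/- (i) Let $S(z)=\sum_{i=1}^d s_i z^i$ be a real polynomial of degree $d$ with nonnegative coefficients and $S(0)=0$ which is aperiodic, that is, not of the form $S(z)=U(z^p)$ with $U$ a polynomial and $p\ge 2$ an integer. Then there is a real polynomial $T$ of degree at most $d-1$ such that, as $n\to\infty$, $$[z^n]\exp(S(z))\;\sim\;\frac{1}{\sqrt{2\pi d n}}\;n^{-n/d}\;\exp\Bigl(\frac nd\bigl(1+\log(d s_d)\bigr)+T\bigl(n^{1/d}\bigr)\Bigr).$$ (ii) Let $\mathcal S$ be a finite class of labeled structures, all of size at least $1$, whose exponential generating series $S(z)=\sum_{\sigma\in\mathcal S} z^{|\sigma|}/|\sigma|!=\sum_{i=1}^d s_iz^i$ has degree $d$ and is aperiodic. Let $t\ge 1$ be an integer such that $\mathcal S$ contains at least one structure of size $t$. An $\mathcal S$-set structure of size $n$ is a set of $\mathcal S$-structures (its components), relabeled in an order-preserving way on pairwise disjoint label sets with union $\{1,\dots,n\}$. Let $\chi_n$ be the number of components of size $t$ in an $\mathcal S$-set structure of size $n$ chosen uniformly at random (such structures exist for all large $n$), and let $c=s_t\,(d s_d)^{-t/d}$.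 Then: (a) $\mathbb E[\chi_n]\sim c\,n^{t/d}$ as $n\to\infty$. (b) There exist real numbers $0<\lambda_0\le 1\le\mu_0$ such that for all $0<\lambda<\lambda_0$ and $\mu>\mu_0$ there is $0<\gamma<1$ with $$\mathbb P\bigl(\chi_n\le\lambda n^{t/d}\bigr)=O\bigl(\gamma^{n^{t/d}}\bigr)\quad\text{and}\quad \mathbb P\bigl(\chi_n\ge\mu n^{t/d}\bigr)=O\bigl(\gamma^{n^{t/d}}\bigr)\qquad(n\to\infty).$$ (c) $\chi_n$ is concentrated around $c\,n^{t/d}$: for all $0<\lambda<c<\mu$ there is $0<\gamma<1$ such that the same two bounds hold. -/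

import Mathlib

open Filter Asymptotics Polynomial ProbabilityTheory

/-- A polynomial `S` is aperiodic if it is not of the form `T(z^p)` for a polynomial `T` and an
integer `p ≥ 2`. -/
def AperiodicPoly (S : ℝ[X]) : Prop :=
  ∀ (p : ℕ) (T : ℝ[X]), 2 ≤ p → S ≠ T.comp (X ^ p)

/-- The formal power series `exp (S(z))` of a polynomial `S` with `S(0) = 0`. -/
noncomputable def expSeries (S : ℝ[X]) : PowerSeries ℝ :=
  (PowerSeries.exp ℝ).subst (S : PowerSeries ℝ)

/-- The exponential generating series `∑_σ z^|σ| / |σ|!` of a finite labeled class `𝒮`, given by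
its (finite) set of structures `σ`, each labeled by `{1, …, |σ|}`, and the size function `σ ↦ |σ|`.
Its coefficient of index `i` is the number of structures of size `i` divided by `i!`. -/
noncomputable def egs {𝒮 : Type*} [Fintype 𝒮] (size : 𝒮 → ℕ) : ℝ[X] :=
  ∑ σ : 𝒮, monomial (size σ) (1 / (Nat.factorial (size σ) : ℝ))

/-- A set of `𝒮`-structures of total size `n`, labeled by an `n`-element set. A component is a
pair `(B, σ)` of a label set `B` and a structure `σ` in `𝒮` of size `|B|`: it stands for the
copy of `σ` in which the labels `1, …, |B|` are replaced, in increasing order, by the elements of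
`B`. The label sets of the components are disjoint and they cover all `n` labels. -/
@[ext]
structure SetStructure {𝒮 : Type*} (size : 𝒮 → ℕ) (n : ℕ) where
  components : Finset (Finset (Fin n) × 𝒮)
  card_eq : ∀ c ∈ components, c.1.card = size c.2
  disjoint : ∀ c ∈ components, ∀ c' ∈ components, c ≠ c' → Disjoint c.1 c'.1
  cover : ∀ i : Fin n, ∃ c ∈ components, i ∈ c.1

/-- The number of components of size `t`. -/
def SetStructure.numComponents {𝒮 : Type*} {size : 𝒮 → ℕ} {n : ℕ} (α : SetStructure size n)
    (t : ℕ) : ℕ :=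
  (α.components.filter fun c => c.1.card = t).card

instance SetStructure.instFinite {𝒮 : Type*} [Finite 𝒮] (size : 𝒮 → ℕ) (n : ℕ) :
    Finite (SetStructure size n) :=
  Finite.of_injective SetStructure.components fun _ _ h => SetStructure.ext h

instance SetStructure.instMeasurableSpace {𝒮 : Type*} (size : 𝒮 → ℕ) (n : ℕ) :
    MeasurableSpace (SetStructure size n) := ⊤

/-- The uniform distribution on the sets of `𝒮`-structures of total size `n`. -/
noncomputable def uniformLaw {𝒮 : Type*} (size : 𝒮 → ℕ) (n : ℕ) :
    MeasureTheory.Measure (SetStructure size n) :=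
  uniformOn Set.univ

/-- The expected value of the number of components of size `t` in a uniform random set of
`𝒮`-structures of total size `n`. -/
noncomputable def expectedComponents {𝒮 : Type*} (size : 𝒮 → ℕ) (t n : ℕ) : ℝ :=
  ∫ α, (α.numComponents t : ℝ) ∂(uniformLaw size n)

/-- The probability that the number of components of size `t` is at most `x`. -/
noncomputable def probComponentsLE {𝒮 : Type*} (size : 𝒮 → ℕ) (t n : ℕ) (x : ℝ) : ℝ :=
  (uniformLaw size n).real {α | (α.numComponents t : ℝ) ≤ x}

/-- The probability that the number of components of size `t` is at least `x`. -/
noncomputable def probComponentsGE {𝒮 : Type*} (size : 𝒮 → ℕ) (t n : ℕ) (x : ℝ) : ℝ :=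
  (uniformLaw size n).real {α | x ≤ (α.numComponents t : ℝ)}

/-- Both tails of the number of components of size `t`, below `lam * n^e` and above `mu * n^e`,
are `O(γ^(n^e))` for some `0 < γ < 1`, as `n` tends to infinity. -/
def ExponentialTails {𝒮 : Type*} (size : 𝒮 → ℕ) (t : ℕ) (e lam mu : ℝ) : Prop :=
  ∃ γ : ℝ, 0 < γ ∧ γ < 1 ∧
    ((fun n : ℕ => probComponentsLE size t n (lam * (n : ℝ) ^ e)) =O[atTop]
      fun n : ℕ => γ ^ ((n : ℝ) ^ e)) ∧
    ((fun n : ℕ => probComponentsGE size t n (mu * (n : ℝ) ^ e)) =O[atTop]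
      fun n : ℕ => γ ^ ((n : ℝ) ^ e))

/-! Part (i) is the saddle point method. Write a_n = [z^n] exp S as a Cauchy integral over |z| = r
and choose r = r_n with r S'(r) = n, so that the exponent, `Polynomial.phase`, has no linear term in
θ. With b(r) = ∑ i² s_i r^i, the integrand is close to exp(-b θ²/2) near θ = 0. For larger θ,
aperiodicity makes it exponentially small in r. Rescaling by √b and dominated convergence
(`Polynomial.tendsto_integral_exp_phase`) give a_n ~ exp(S(r_n)) r_n^(-n) / √(2π b(r_n)), where
b(r_n) ~ d n.

The polynomial T comes from expanding S(r_n) - n log r_n (`Polynomial.exists_saddle`). In the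
variables w = 1/r and u = n^(-1/d) the saddle equation has a solution w(u) smooth at u = 0. After
removal of the log n term, the exponent is n F(u) with F smooth. As n u^i = (n^(1/d))^(d-i), the
Taylor terms 1, ..., d of F form T, and the remainder is n o(u^d) = o(1).

For part (ii), an extra factor e^(itθ) under the same integral produces a_(n-t) at the same radius,
so a_(n-t)/a_n ~ r_n^t ~ (n/(d s_d))^(t/d). The exponential formula (`weightedCount_eq`), together
with marking one component, gives E χ_n = s_t a_(n-t)/a_n, hence (a).

The same formula gives E w^χ_n = [z^n] exp(S + (w-1) s_t z^t) / a_n. Bounding the numerator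
trivially on the circle of radius r_n yields exp(((w-1)c + o(1)) n^(t/d)), and Markov's inequality
with a suitable w gives both tails of (c). Then (b) is the special case λ₀ = min(1,c), μ₀ =
max(1,c). -/

/-! ### Cauchy's formula and the trivial coefficient bound for exp S -/

theorem integral_exp_nat_mul_exp_neg (m n : ℕ) :
    ∫ θ in (-Real.pi)..Real.pi, Complex.exp (m * (θ * Complex.I)) *
      Complex.exp (-(n * (θ * Complex.I))) = if m = n then 2 * (Real.pi : ℂ) else 0 := by
  have h1 : ∀ θ : ℝ, Complex.exp (m * (θ * Complex.I)) * Complex.exp (-(n * (θ * Complex.I)))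
      = Complex.exp ((((m : ℂ) - n) * Complex.I) * θ) := by
    intro θ; rw [← Complex.exp_add]; congr 1; ring
  simp_rw [h1]
  split_ifs with h
  · subst h; simp; ring
  · have hc : ((m : ℂ) - n) * Complex.I ≠ 0 :=
      mul_ne_zero (sub_ne_zero.2 (by exact_mod_cast h)) Complex.I_ne_zero
    rw [integral_exp_mul_complex hc]
    have : Complex.exp (((m : ℂ) - n) * Complex.I * (Real.pi : ℝ)) =
        Complex.exp (((m : ℂ) - n) * Complex.I * ((-Real.pi : ℝ) : ℂ)) := by
      rw [Complex.exp_eq_exp_iff_exists_int]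
      exact ⟨(m : ℤ) - n, by push_cast; ring⟩
    rw [this, sub_self, zero_div]

theorem Polynomial.integral_eval_circle (P : ℂ[X]) (r : ℝ) (n : ℕ) :
    ∫ θ in (-Real.pi)..Real.pi, P.eval (r * Complex.exp (θ * Complex.I)) *
      Complex.exp (-(n * (θ * Complex.I))) = 2 * Real.pi * P.coeff n * r ^ n := by
  induction P using Polynomial.induction_on' with
  | add p q hp hq =>
    simp_rw [eval_add, add_mul]
    rw [intervalIntegral.integral_add, hp, hq, coeff_add]
    · ring
    all_goals exact Continuous.intervalIntegrable (by fun_prop) _ _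
  | monomial m a =>
    have : ∀ θ : ℝ, (monomial m a).eval (r * Complex.exp (θ * Complex.I)) *
      Complex.exp (-(n * (θ * Complex.I))) = (a * r ^ m) * (Complex.exp (m * (θ * Complex.I)) *
        Complex.exp (-(n * (θ * Complex.I)))) := by
      intro θ
      rw [eval_monomial, mul_pow, ← Complex.exp_nat_mul]; ring
    simp_rw [this]
    rw [intervalIntegral.integral_const_mul, integral_exp_nat_mul_exp_neg, coeff_monomial]
    split_ifs with h
    · subst h; ring
    · simp

theorem hasSubst_of_coeff_zero {S : ℝ[X]} (h0 : S.coeff 0 = 0) :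
    PowerSeries.HasSubst (S : PowerSeries ℝ) :=
  PowerSeries.HasSubst.of_constantCoeff_zero' (by simpa using h0)

/-- Because S(0) = 0, only finitely many powers of S reach degree n, so the formal substitution is a
genuine sum of reals that can be compared with analytic series. -/
theorem hasSum_coeff_expSeries {S : ℝ[X]} (h0 : S.coeff 0 = 0) (n : ℕ) :
    HasSum (fun k : ℕ => (S ^ k).coeff n / (k.factorial : ℝ))
      (PowerSeries.coeff n (expSeries S)) := by
  have h := PowerSeries.coeff_subst' (hasSubst_of_coeff_zero h0) (PowerSeries.exp ℝ) n
  have hf := PowerSeries.coeff_subst_finite' (hasSubst_of_coeff_zero h0) (PowerSeries.exp ℝ) n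
  rw [expSeries, h]
  have e : (fun k : ℕ => (S ^ k).coeff n / (k.factorial : ℝ)) = fun k =>
      PowerSeries.coeff k (PowerSeries.exp ℝ) • PowerSeries.coeff n ((S : PowerSeries ℝ) ^ k) := by
    ext k
    rw [← Polynomial.coe_pow, Polynomial.coeff_coe, PowerSeries.coeff_exp]
    simp [div_eq_inv_mul]
  rw [e, ← tsum_eq_finsum (L := .unconditional ℕ) hf]
  exact (summable_of_hasFiniteSupport hf).hasSum

theorem coeff_expSeries_nonneg {S : ℝ[X]} (h0 : S.coeff 0 = 0) (hS : ∀ i, 0 ≤ S.coeff i) (n : ℕ) :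
    0 ≤ PowerSeries.coeff n (expSeries S) := by
  refine (hasSum_coeff_expSeries h0 n).nonneg fun k => div_nonneg ?_ (by positivity)
  induction k generalizing n with
  | zero => rw [pow_zero, coeff_one]; split_ifs <;> norm_num
  | succ k ih =>
    rw [pow_succ, coeff_mul]
    exact Finset.sum_nonneg fun x _ => mul_nonneg (ih _) (hS _)

/-- Expand exp(S) in powers of S and integrate term by term. A bound M for |S| on the circle
provides the summable majorant M^k/k!, and each power is a polynomial, handled by orthogonality. -/
theorem integral_exp_eval_circle {S : ℝ[X]} (h0 : S.coeff 0 = 0) (r : ℝ) (n : ℕ) :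
    ∫ θ in (-Real.pi)..Real.pi,
      Complex.exp ((S.map Complex.ofRealHom).eval (r * Complex.exp (θ * Complex.I))) *
        Complex.exp (-(n * (θ * Complex.I))) =
      2 * Real.pi * (PowerSeries.coeff n (expSeries S) : ℝ) * r ^ n := by
  set Q := S.map Complex.ofRealHom
  obtain ⟨M, hM⟩ : ∃ M : ℝ, ∀ θ ∈ Set.uIcc (-Real.pi) Real.pi,
      ‖Q.eval (r * Complex.exp (θ * Complex.I))‖ ≤ M := by
    have := (isCompact_uIcc (a := -Real.pi) (b := Real.pi)).exists_bound_of_continuousOn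
      (f := fun θ : ℝ => Q.eval (r * Complex.exp (θ * Complex.I)))
      (Continuous.continuousOn (by fun_prop))
    exact this
  have key := intervalIntegral.hasSum_integral_of_dominated_convergence
    (μ := MeasureTheory.volume) (a := -Real.pi) (b := Real.pi)
    (F := fun (k : ℕ) (θ : ℝ) => (Q.eval (r * Complex.exp (θ * Complex.I))) ^ k / k.factorial *
        Complex.exp (-(n * (θ * Complex.I))))
    (f := fun θ : ℝ => Complex.exp (Q.eval (r * Complex.exp (θ * Complex.I))) *
        Complex.exp (-(n * (θ * Complex.I))))
    (fun k _ => M ^ k / k.factorial)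
    (fun k => Continuous.aestronglyMeasurable (by fun_prop))
    (fun k => .of_forall fun θ hθ => by
      have h1 : ‖Complex.exp (-(n * (θ * Complex.I)))‖ = 1 := by
        rw [Complex.norm_exp]; simp
      rw [norm_mul, h1, mul_one, norm_div, norm_pow, Complex.norm_natCast]
      gcongr
      exact hM θ (Set.uIoc_subset_uIcc hθ))
    (.of_forall fun θ _ => Real.summable_pow_div_factorial M)
    (by simp)
    (.of_forall fun θ _ => by
      refine HasSum.mul_right _ ?_
      have := NormedSpace.expSeries_div_hasSum_exp (𝔸 := ℂ)
        (Q.eval (r * Complex.exp (θ * Complex.I)))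
      rwa [← Complex.exp_eq_exp_ℂ] at this)
  refine key.unique ?_
  have h2 := ((Complex.hasSum_ofReal.2 (hasSum_coeff_expSeries h0 n)).mul_left
    (2 * (Real.pi : ℂ))).mul_right ((r : ℂ) ^ n)
  have e : ∀ k : ℕ, ∫ θ in (-Real.pi)..Real.pi,
      (Q.eval (r * Complex.exp (θ * Complex.I))) ^ k / k.factorial *
        Complex.exp (-(n * (θ * Complex.I))) =
      2 * (Real.pi : ℂ) * (((S ^ k).coeff n / (k.factorial : ℝ) : ℝ) : ℂ) * (r : ℂ) ^ n := by
    intro k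
    have : ∀ θ : ℝ, (Q.eval (r * Complex.exp (θ * Complex.I))) ^ k / k.factorial *
        Complex.exp (-(n * (θ * Complex.I))) = (1 / k.factorial : ℂ) *
        ((Q ^ k).eval (r * Complex.exp (θ * Complex.I)) *
          Complex.exp (-(n * (θ * Complex.I)))) := by
      intro θ; rw [eval_pow]; ring
    simp_rw [this]
    rw [intervalIntegral.integral_const_mul, Polynomial.integral_eval_circle, ← Polynomial.map_pow,
      coeff_map]
    simp
    ring
  simp_rw [e]
  exact h2

/-- With nonnegative coefficients, one term of S(r)^k is at most the whole. This crude bound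
suffices for the tilted polynomials in the tail estimates, so they need no saddle point analysis. -/
theorem coeff_expSeries_mul_pow_le {S : ℝ[X]} (h0 : S.coeff 0 = 0) (hS : ∀ i, 0 ≤ S.coeff i)
    {r : ℝ} (hr : 0 ≤ r) (n : ℕ) :
    PowerSeries.coeff n (expSeries S) * r ^ n ≤ Real.exp (S.eval r) := by
  have h1 : HasSum (fun k : ℕ => (S.eval r) ^ k / (k.factorial : ℝ)) (Real.exp (S.eval r)) := by
    rw [Real.exp_eq_exp_ℝ]
    exact NormedSpace.expSeries_div_hasSum_exp (𝔸 := ℝ) (S.eval r)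
  refine hasSum_le (fun k => ?_) ((hasSum_coeff_expSeries h0 n).mul_right (r ^ n)) h1
  have hk : ∀ m, 0 ≤ (S ^ k).coeff m := by
    induction k with
    | zero => intro m; rw [pow_zero, coeff_one]; split_ifs <;> norm_num
    | succ k ih =>
      intro m
      rw [pow_succ, coeff_mul]
      exact Finset.sum_nonneg fun x _ => mul_nonneg (ih _) (hS _)
  rw [div_mul_eq_mul_div, ← eval_pow]
  gcongr
  rw [eval_eq_sum]
  by_cases hn : n ∈ (S ^ k).support
  · exact Finset.single_le_sum (f := fun i => (S ^ k).coeff i * r ^ i)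
      (fun i _ => mul_nonneg (hk i) (by positivity)) hn
  · rw [notMem_support_iff.1 hn, zero_mul]
    exact Finset.sum_nonneg fun i _ => mul_nonneg (hk i) (by positivity)

/-! ### Consequences of aperiodicity -/

/-- The order p of z divides every exponent of S, so p ≥ 2 would make S a polynomial in z^p. -/
theorem AperiodicPoly.eq_one_of_pow_eq_one {S : ℝ[X]} (hS : AperiodicPoly S) {z : ℂ}
    (hz : ∀ i, S.coeff i ≠ 0 → z ^ i = 1) : z = 1 := by
  have hd : ∀ i, S.coeff i ≠ 0 → orderOf z ∣ i := fun i hi => orderOf_dvd_of_pow_eq_one (hz i hi)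
  have key : ∀ p : ℕ, 2 ≤ p → ¬ ∀ i, S.coeff i ≠ 0 → p ∣ i := by
    intro p hp h
    refine hS p (contract p S) hp ?_
    rw [← expand_eq_comp_X_pow]
    ext i
    rw [coeff_expand (by omega), coeff_contract (by omega)]
    split_ifs with hi
    · rw [Nat.div_mul_cancel hi]
    · by_contra h'
      exact hi (h i h')
  rcases lt_or_ge (orderOf z) 2 with h | h
  · interval_cases ho : orderOf z
    -- Order 0 encodes infinite order: then 0 is the only possible exponent, S is constant, and p =
    -- 2 already contradicts aperiodicity.
    · exact (key 2 le_rfl fun i hi => by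
        have := hd i hi
        rw [zero_dvd_iff] at this; simp [this]).elim
    · exact orderOf_eq_one_iff.1 ho
  · exact (key _ h hd).elim

theorem AperiodicPoly.natDegree_pos {S : ℝ[X]} (hS : AperiodicPoly S) : 0 < S.natDegree := by
  rw [Nat.pos_iff_ne_zero]
  intro h
  refine hS 2 S le_rfl ?_
  rw [eq_C_of_natDegree_eq_zero h, C_comp]

theorem AperiodicPoly.coeff_natDegree_pos {S : ℝ[X]} (hS : AperiodicPoly S)
    (hn : ∀ i, 0 ≤ S.coeff i) : 0 < S.coeff S.natDegree := by
  refine (hn _).lt_of_ne' ?_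
  rw [coeff_natDegree, leadingCoeff_ne_zero]
  rintro rfl
  simpa using hS.natDegree_pos

/-- The sum is continuous on a compact set. If its minimum were 0, then e^(iθ₀) would be a root of
unity killing all exponents of S, hence 1, which δ ≤ |θ₀| ≤ π excludes. -/
theorem AperiodicPoly.exists_tail_gap {S : ℝ[X]} (hS : AperiodicPoly S)
    (hn : ∀ i, 0 ≤ S.coeff i) {δ : ℝ} (hδ : 0 < δ) :
    ∃ κ > 0, ∀ θ : ℝ, δ ≤ |θ| → |θ| ≤ Real.pi →
      κ ≤ ∑ i ∈ Finset.range (S.natDegree + 1), S.coeff i * (1 - Real.cos (i * θ)) := by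
  set K : Set ℝ := {θ | δ ≤ |θ| ∧ |θ| ≤ Real.pi}
  have hK : IsCompact K := by
    refine Metric.isCompact_of_isClosed_isBounded ?_ ?_
    · exact (isClosed_le continuous_const continuous_abs).inter
        (isClosed_le continuous_abs continuous_const)
    · refine (Metric.isBounded_Icc (-Real.pi) Real.pi).subset fun θ hθ => abs_le.1 hθ.2
  have hterm : ∀ θ : ℝ, ∀ i ∈ Finset.range (S.natDegree + 1),
      0 ≤ S.coeff i * (1 - Real.cos (i * θ)) := fun θ i _ =>
    mul_nonneg (hn i) (sub_nonneg.2 (Real.cos_le_one _))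
  obtain hK0 | hK0 := K.eq_empty_or_nonempty
  · refine ⟨1, one_pos, fun θ h1 h2 => ?_⟩
    have : θ ∈ K := ⟨h1, h2⟩
    simp [hK0] at this
  obtain ⟨θ₀, h₀, hmin⟩ := hK.exists_isMinOn hK0 (f := fun θ : ℝ =>
    ∑ i ∈ Finset.range (S.natDegree + 1), S.coeff i * (1 - Real.cos (i * θ)))
    (Continuous.continuousOn (by fun_prop))
  refine ⟨_, ?_, fun θ h1 h2 => hmin (a := θ) ⟨h1, h2⟩⟩
  refine (Finset.sum_nonneg (hterm θ₀)).lt_of_ne' fun hz => ?_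
  rw [Finset.sum_eq_zero_iff_of_nonneg (hterm θ₀)] at hz
  have h1 : Complex.exp (θ₀ * Complex.I) = 1 := by
    refine hS.eq_one_of_pow_eq_one fun i hi => ?_
    have := hz i (Finset.mem_range.2 (Nat.lt_succ_of_le (le_natDegree_of_ne_zero hi)))
    have hc : Real.cos (i * θ₀) = 1 := by
      rcases mul_eq_zero.1 this with h | h
      · exact (hi h).elim
      · linarith
    obtain ⟨k, hk⟩ := (Real.cos_eq_one_iff _).1 hc
    rw [← Complex.exp_nat_mul, Complex.exp_eq_one_iff]
    refine ⟨k, ?_⟩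
    have : ((k * (2 * Real.pi) : ℝ) : ℂ) = ((i * θ₀ : ℝ) : ℂ) := by rw [hk]
    push_cast at this
    linear_combination (-Complex.I) * this
  obtain ⟨k, hk⟩ := Complex.exp_eq_one_iff.1 h1
  have h2 : θ₀ = k * (2 * Real.pi) := by
    have : (θ₀ : ℂ) * Complex.I = ((k * (2 * Real.pi) : ℝ) : ℂ) * Complex.I := by
      rw [hk]; push_cast; ring
    exact_mod_cast mul_right_cancel₀ Complex.I_ne_zero this
  have hk0 : k = 0 := by
    have h3 : |(k : ℝ)| * (2 * Real.pi) ≤ Real.pi := by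
      have := h₀.2
      rwa [h2, abs_mul, abs_of_pos (by positivity : (0:ℝ) < 2 * Real.pi)] at this
    have h4 : |(k : ℝ)| < 1 := by nlinarith [Real.pi_pos]
    have : |k| < 1 := by exact_mod_cast h4
    exact Int.abs_lt_one_iff.1 this
  have := h₀.1
  rw [h2, hk0] at this
  simp at this
  linarith

/-! ### The saddle point integral -/

/-- `r S'(r) = ∑ i s_i r^i`. -/
noncomputable def Polynomial.firstMoment (S : ℝ[X]) (r : ℝ) : ℝ :=
  ∑ i ∈ Finset.range (S.natDegree + 1), (i : ℝ) * (S.coeff i * r ^ i)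

/-- `∑ i² s_i r^i`. -/
noncomputable def Polynomial.secondMoment (S : ℝ[X]) (r : ℝ) : ℝ :=
  ∑ i ∈ Finset.range (S.natDegree + 1), (i : ℝ) ^ 2 * (S.coeff i * r ^ i)

/-- The exponent `S(r e^{iθ}) - S(r) - iθ r S'(r)` of the saddle point integrand. -/
noncomputable def Polynomial.phase (S : ℝ[X]) (r θ : ℝ) : ℂ :=
  ∑ i ∈ Finset.range (S.natDegree + 1), ((S.coeff i * r ^ i : ℝ) : ℂ) *
    (Complex.exp (((i * θ : ℝ) : ℂ) * Complex.I) - 1 - ((i * θ : ℝ) : ℂ) * Complex.I)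

theorem Polynomial.continuous_phase (S : ℝ[X]) (r : ℝ) : Continuous (S.phase r) := by
  unfold Polynomial.phase; fun_prop

theorem Polynomial.norm_exp_phase (S : ℝ[X]) (r θ : ℝ) :
    ‖Complex.exp (S.phase r θ)‖ = Real.exp (-∑ i ∈ Finset.range (S.natDegree + 1),
      S.coeff i * r ^ i * (1 - Real.cos (i * θ))) := by
  rw [Complex.norm_exp, Polynomial.phase, Complex.re_sum, ← Finset.sum_neg_distrib]
  congr 1
  refine Finset.sum_congr rfl fun i _ => ?_
  rw [Complex.re_ofReal_mul, Complex.sub_re, Complex.sub_re, Complex.exp_ofReal_mul_I_re]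
  simp
  ring

section
variable {S : ℝ[X]}

theorem Polynomial.secondMoment_le (hn : ∀ i, 0 ≤ S.coeff i) {r : ℝ} (hr : 1 ≤ r) :
    S.secondMoment r ≤ S.secondMoment 1 * r ^ S.natDegree := by
  unfold Polynomial.secondMoment
  rw [Finset.sum_mul]
  refine Finset.sum_le_sum fun i hi => ?_
  have := Finset.mem_range.1 hi
  have h1 : r ^ i ≤ r ^ S.natDegree := pow_le_pow_right₀ hr (by omega)
  rw [one_pow, mul_one, ← mul_assoc]
  exact mul_le_mul_of_nonneg_left h1 (mul_nonneg (by positivity) (hn i))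

theorem Polynomial.le_secondMoment (hS : AperiodicPoly S) (hn : ∀ i, 0 ≤ S.coeff i) {r : ℝ}
    (hr : 0 ≤ r) : S.coeff S.natDegree * r ^ S.natDegree ≤ S.secondMoment r := by
  have h1 : (1 : ℝ) ≤ S.natDegree := by exact_mod_cast hS.natDegree_pos
  calc S.coeff S.natDegree * r ^ S.natDegree
      ≤ (S.natDegree : ℝ) ^ 2 * (S.coeff S.natDegree * r ^ S.natDegree) :=
        le_mul_of_one_le_left (mul_nonneg (hn _) (by positivity)) (one_le_pow₀ h1)
    _ ≤ _ := Finset.single_le_sum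
        (f := fun i : ℕ => (i : ℝ) ^ 2 * (S.coeff i * r ^ i))
        (fun i _ => mul_nonneg (by positivity) (mul_nonneg (hn i) (by positivity)))
        (Finset.self_mem_range_succ _)

theorem Polynomial.tendsto_secondMoment (hS : AperiodicPoly S) (hn : ∀ i, 0 ≤ S.coeff i) :
    Tendsto S.secondMoment atTop atTop := by
  refine tendsto_atTop_mono' _ ?_ ((tendsto_pow_atTop hS.natDegree_pos.ne').const_mul_atTop
    (hS.coeff_natDegree_pos hn))
  filter_upwards [eventually_ge_atTop 0] with r hr using Polynomial.le_secondMoment hS hn hr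

/-- Only the leading term is kept: 1 - cos(dθ) ≥ (2/π²)(dθ)² as long as |dθ| ≤ π, and r^d is
comparable to the second moment for r ≥ 1. -/
theorem Polynomial.norm_exp_phase_le_gaussian (hS : AperiodicPoly S) (hn : ∀ i, 0 ≤ S.coeff i)
    {r θ : ℝ} (hr : 1 ≤ r) (hθ : |θ| ≤ Real.pi / S.natDegree) :
    ‖Complex.exp (S.phase r θ)‖ ≤ Real.exp (-(2 / Real.pi ^ 2 * S.coeff S.natDegree /
      S.secondMoment 1) * (S.secondMoment r * θ ^ 2)) := by
  have hd : (0 : ℝ) < S.natDegree := by exact_mod_cast hS.natDegree_pos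
  have hd1 : (1 : ℝ) ≤ S.natDegree := by exact_mod_cast hS.natDegree_pos
  have hs := hS.coeff_natDegree_pos hn
  have hB : 0 < S.secondMoment 1 := by
    refine lt_of_lt_of_le ?_ (Polynomial.le_secondMoment hS hn zero_le_one)
    simpa using hs
  rw [Polynomial.norm_exp_phase, Real.exp_le_exp, neg_mul, neg_le_neg_iff]
  calc 2 / Real.pi ^ 2 * S.coeff S.natDegree / S.secondMoment 1 * (S.secondMoment r * θ ^ 2)
      ≤ 2 / Real.pi ^ 2 * S.coeff S.natDegree / S.secondMoment 1 *
        ((S.secondMoment 1 * r ^ S.natDegree) * θ ^ 2) := by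
        gcongr
        exact Polynomial.secondMoment_le hn hr
    _ = S.coeff S.natDegree * r ^ S.natDegree * (2 / Real.pi ^ 2 * θ ^ 2) := by
        field_simp
    _ ≤ S.coeff S.natDegree * r ^ S.natDegree * (1 - Real.cos (S.natDegree * θ)) := by
        have h1 : |(S.natDegree : ℝ) * θ| ≤ Real.pi := by
          rw [abs_mul, abs_of_pos hd]
          rw [le_div_iff₀ hd] at hθ
          linarith
        have h2 := Real.cos_le_one_sub_mul_cos_sq h1
        have h3 : θ ^ 2 ≤ (S.natDegree * θ) ^ 2 := by
          rw [mul_pow]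
          exact le_mul_of_one_le_left (sq_nonneg _) (one_le_pow₀ hd1)
        have h4 : 2 / Real.pi ^ 2 * θ ^ 2 ≤ 2 / Real.pi ^ 2 * (S.natDegree * θ) ^ 2 :=
          mul_le_mul_of_nonneg_left h3 (by positivity)
        exact mul_le_mul_of_nonneg_left (by linarith) (by positivity)
    _ ≤ _ := Finset.single_le_sum
        (f := fun i : ℕ => S.coeff i * r ^ i * (1 - Real.cos (i * θ)))
        (fun i _ => mul_nonneg (mul_nonneg (hn i) (by positivity))
          (sub_nonneg.2 (Real.cos_le_one _)))
        (Finset.self_mem_range_succ _)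

theorem Polynomial.norm_exp_phase_le_of_gap (hn : ∀ i, 0 ≤ S.coeff i)
    {r θ κ : ℝ} (hr : 1 ≤ r)
    (h : κ ≤ ∑ i ∈ Finset.range (S.natDegree + 1), S.coeff i * (1 - Real.cos (i * θ))) :
    ‖Complex.exp (S.phase r θ)‖ ≤ Real.exp (-(κ * r)) := by
  rw [Polynomial.norm_exp_phase, Real.exp_le_exp, neg_le_neg_iff]
  refine (mul_le_mul_of_nonneg_right h (by positivity)).trans ?_
  rw [Finset.sum_mul]
  refine Finset.sum_le_sum fun i _ => ?_
  rcases Nat.eq_zero_or_pos i with rfl | hi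
  · simp
  · have h1 : r ≤ r ^ i := le_self_pow₀ hr hi.ne'
    calc S.coeff i * (1 - Real.cos (i * θ)) * r = S.coeff i * r * (1 - Real.cos (i * θ)) := by ring
      _ ≤ _ := by
        gcongr
        · exact sub_nonneg.2 (Real.cos_le_one _)
        · exact hn i

/-- The quadratic Taylor polynomial of each exponential accounts for the left-hand correction; the
cubic remainder |iθ|³ is at most (iθ)² · d|θ|. -/
theorem Polynomial.norm_phase_add_le (hn : ∀ i, 0 ≤ S.coeff i) {r θ : ℝ} (hr : 0 ≤ r)
    (hθ : S.natDegree * |θ| ≤ 1) :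
    ‖S.phase r θ + (S.secondMoment r * θ ^ 2 / 2 : ℝ)‖ ≤
      S.natDegree * |θ| * (S.secondMoment r * θ ^ 2) := by
  have e : S.phase r θ + (S.secondMoment r * θ ^ 2 / 2 : ℝ) =
      ∑ i ∈ Finset.range (S.natDegree + 1), ((S.coeff i * r ^ i : ℝ) : ℂ) *
        (Complex.exp (((i * θ : ℝ) : ℂ) * Complex.I) -
          ∑ m ∈ Finset.range 3, (((i * θ : ℝ) : ℂ) * Complex.I) ^ m / m.factorial) := by
    rw [Polynomial.phase, Polynomial.secondMoment, Finset.sum_mul, Finset.sum_div,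
      Complex.ofReal_sum, ← Finset.sum_add_distrib]
    refine Finset.sum_congr rfl fun i _ => ?_
    simp only [Finset.sum_range_succ, Finset.sum_range_zero, Nat.factorial, mul_pow, Complex.I_sq]
    push_cast
    ring
  have e2 : S.natDegree * |θ| * (S.secondMoment r * θ ^ 2) =
      ∑ i ∈ Finset.range (S.natDegree + 1),
        S.coeff i * r ^ i * ((i * |θ|) ^ 2 * (S.natDegree * |θ|)) := by
    rw [Polynomial.secondMoment, Finset.sum_mul, Finset.mul_sum]
    refine Finset.sum_congr rfl fun i _ => ?_
    rw [mul_pow, sq_abs]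
    ring
  rw [e, e2]
  refine (norm_sum_le _ _).trans (Finset.sum_le_sum fun i hi => ?_)
  have hi' : (i : ℝ) ≤ S.natDegree := by exact_mod_cast Nat.lt_succ_iff.1 (Finset.mem_range.1 hi)
  have h1 : ‖((i * θ : ℝ) : ℂ) * Complex.I‖ = i * |θ| := by
    rw [norm_mul, Complex.norm_I, mul_one, Complex.norm_real, Real.norm_eq_abs, abs_mul,
      Nat.abs_cast]
  have h2 : (i : ℝ) * |θ| ≤ S.natDegree * |θ| := by gcongr
  have h3 := Complex.exp_bound (x := ((i * θ : ℝ) : ℂ) * Complex.I) (h1.trans_le (h2.trans hθ))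
    (n := 3) (by norm_num)
  rw [norm_mul, Complex.norm_real, Real.norm_of_nonneg (mul_nonneg (hn i) (by positivity))]
  refine mul_le_mul_of_nonneg_left (h3.trans ?_) (mul_nonneg (hn i) (by positivity))
  rw [h1]
  calc ((i : ℝ) * |θ|) ^ 3 * ((Nat.succ 3 : ℕ) * ((Nat.factorial 3 : ℕ) * (3 : ℕ) : ℝ)⁻¹)
      ≤ ((i : ℝ) * |θ|) ^ 3 * 1 := by
        gcongr
        norm_num [Nat.factorial]
    _ = ((i : ℝ) * |θ|) ^ 2 * (i * |θ|) := by ring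
    _ ≤ _ := by gcongr

/-- The saddle point integral is asymptotic to a Gaussian integral. -/
theorem Polynomial.tendsto_integral_exp_phase (hS : AperiodicPoly S) (hn : ∀ i, 0 ≤ S.coeff i)
    (t : ℕ) :
    Tendsto (fun r : ℝ => (√(S.secondMoment r) : ℂ) * ∫ θ in (-Real.pi)..Real.pi,
      Complex.exp (S.phase r θ) * Complex.exp (((t * θ : ℝ) : ℂ) * Complex.I)) atTop
      (nhds (√(2 * Real.pi) : ℂ)) := by
  set σ : ℝ → ℝ := fun r => √(S.secondMoment r) with hσ
  have hσ_top : Tendsto σ atTop atTop :=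
    Real.tendsto_sqrt_atTop.comp (Polynomial.tendsto_secondMoment hS hn)
  have hd : (0 : ℝ) < S.natDegree := by exact_mod_cast hS.natDegree_pos
  obtain ⟨κ, hκ, hgap⟩ := hS.exists_tail_gap hn (δ := Real.pi / S.natDegree) (by positivity)
  set c := 2 / Real.pi ^ 2 * S.coeff S.natDegree / S.secondMoment 1 with hc
  have hB : 0 < S.secondMoment 1 := by
    refine lt_of_lt_of_le ?_ (Polynomial.le_secondMoment hS hn zero_le_one)
    simpa using hS.coeff_natDegree_pos hn
  have hcpos : 0 < c := by
    have := hS.coeff_natDegree_pos hn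
    positivity
  set f : ℝ → ℝ → ℂ := fun r θ =>
    Complex.exp (S.phase r θ) * Complex.exp (((t * θ : ℝ) : ℂ) * Complex.I) with hf
  have hfc : ∀ r, Continuous (f r) := fun r => by
    have := Polynomial.continuous_phase S r
    fun_prop
  have hnorm : ∀ r θ, ‖f r θ‖ = ‖Complex.exp (S.phase r θ)‖ := fun r θ => by
    rw [hf]; simp only [norm_mul, Complex.norm_exp_ofReal_mul_I, mul_one]
  have hsub : ∀ᶠ r in atTop, (σ r : ℂ) * ∫ θ in (-Real.pi)..Real.pi, f r θ =
      ∫ x, (Set.Ioc (-Real.pi * σ r) (Real.pi * σ r)).indicator (fun x => f r (x / σ r)) x := by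
    filter_upwards [hσ_top.eventually_gt_atTop 0] with r hr
    rw [MeasureTheory.integral_indicator measurableSet_Ioc, ← intervalIntegral.integral_of_le
      (by nlinarith [Real.pi_pos]), intervalIntegral.integral_comp_div _ hr.ne',
      mul_div_cancel_right₀ _ hr.ne', mul_div_cancel_right₀ _ hr.ne', Complex.real_smul]
  have hg : ∫ x : ℝ, (Real.exp (-(1 / 2) * x ^ 2) : ℂ) = (√(2 * Real.pi) : ℂ) := by
    rw [integral_complex_ofReal, integral_gaussian]
    congr 3
    ring
  rw [← hg]
  refine Tendsto.congr' (hsub.mono fun r h => h.symm) ?_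
  -- After θ = x/σ, the Gaussian majorant serves |θ| ≤ π/d. Beyond that the integrand is at most
  -- e^(-κr), while 1 + x² is at most polynomial in r, so 1/(1 + x²) serves for large r.
  refine MeasureTheory.tendsto_integral_filter_of_dominated_convergence
    (fun x => Real.exp (-c * x ^ 2) + (1 + x ^ 2)⁻¹) ?_ ?_ ?_ ?_
  · exact .of_forall fun r => ((Continuous.aestronglyMeasurable (by fun_prop)).indicator
      measurableSet_Ioc)
  · have hdecay : ∀ᶠ r : ℝ in atTop, (1 + Real.pi ^ 2 * (S.secondMoment 1 * r ^ S.natDegree)) *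
        Real.exp (-(κ * r)) ≤ 1 := by
      have h1 : Tendsto (fun r : ℝ => Real.exp (-(κ * r))) atTop (nhds 0) :=
        Real.tendsto_exp_neg_atTop_nhds_zero.comp (tendsto_id.const_mul_atTop hκ)
      have h2 : Tendsto (fun r : ℝ => r ^ S.natDegree * Real.exp (-(κ * r))) atTop (nhds 0) := by
        have h3 := (Real.tendsto_pow_mul_exp_neg_atTop_nhds_zero S.natDegree).comp
          (tendsto_id.const_mul_atTop hκ)
        have h4 := h3.const_mul ((κ ^ S.natDegree)⁻¹)
        rw [mul_zero] at h4
        refine h4.congr fun r => ?_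
        simp only [Function.comp_apply, id_eq, mul_pow]
        field_simp
      have h5 := h1.add (h2.const_mul (Real.pi ^ 2 * S.secondMoment 1))
      rw [mul_zero, add_zero] at h5
      filter_upwards [h5.eventually_le_const one_pos] with r hr
      refine le_trans (le_of_eq ?_) hr
      ring
    filter_upwards [hdecay, eventually_ge_atTop 1, hσ_top.eventually_gt_atTop 0] with r h1 hr hs
    refine .of_forall fun x => ?_
    by_cases hx : x ∈ Set.Ioc (-Real.pi * σ r) (Real.pi * σ r)
    · rw [Set.indicator_of_mem hx, hnorm]
      have hb : 0 < S.secondMoment r := Real.sqrt_pos.1 hs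
      have hsq : S.secondMoment r * (x / σ r) ^ 2 = x ^ 2 := by
        rw [div_pow, hσ]; simp only []; rw [Real.sq_sqrt hb.le]; field_simp
      have hxa : |x / σ r| ≤ Real.pi := by
        rw [abs_div, abs_of_pos hs, div_le_iff₀ hs, abs_le]
        constructor <;> linarith [hx.1, hx.2]
      rcases le_total |x / σ r| (Real.pi / S.natDegree) with h | h
      · refine (Polynomial.norm_exp_phase_le_gaussian hS hn hr h).trans ?_
        rw [hsq]
        exact le_add_of_nonneg_right (by positivity)
      · refine (Polynomial.norm_exp_phase_le_of_gap hn hr (hgap _ h hxa)).trans ?_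
        refine le_trans ?_ (le_add_of_nonneg_left (Real.exp_pos _).le)
        rw [← one_div, le_div_iff₀ (by positivity), mul_comm]
        refine le_trans (mul_le_mul_of_nonneg_right ?_ (Real.exp_pos _).le) h1
        have h2 : x ^ 2 ≤ Real.pi ^ 2 * S.secondMoment r := by
          rw [← hsq, mul_comm]
          exact mul_le_mul_of_nonneg_right (sq_le_sq' (by linarith [(abs_le.1 hxa).1])
            (abs_le.1 hxa).2) hb.le
        have := mul_le_mul_of_nonneg_left (Polynomial.secondMoment_le hn hr)
          (sq_nonneg Real.pi)
        linarith
    · rw [Set.indicator_of_notMem hx, norm_zero]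
      positivity
  · exact (integrable_exp_neg_mul_sq hcpos).add integrable_inv_one_add_sq
  · refine .of_forall fun x => ?_
    have hθ : Tendsto (fun r => x / σ r) atTop (nhds 0) := hσ_top.const_div_atTop x
    have h1 : ∀ᶠ r in atTop, x ∈ Set.Ioc (-Real.pi * σ r) (Real.pi * σ r) := by
      filter_upwards [(hσ_top.const_mul_atTop Real.pi_pos).eventually_gt_atTop |x|] with r hr
      have := abs_lt.1 hr
      exact ⟨by linarith, by linarith⟩
    have h2 : Tendsto (fun r => S.phase r (x / σ r)) atTop (nhds (-(1 / 2) * x ^ 2 : ℂ)) := by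
      rw [tendsto_iff_norm_sub_tendsto_zero]
      have hlim : Tendsto (fun r => S.natDegree * |x / σ r| * x ^ 2) atTop (nhds 0) := by
        have := (hθ.abs.const_mul (S.natDegree : ℝ)).mul_const (x ^ 2)
        simpa using this
      have hsmall : Tendsto (fun r => S.natDegree * |x / σ r|) atTop (nhds 0) := by
        simpa using hθ.abs.const_mul (S.natDegree : ℝ)
      refine squeeze_zero' (.of_forall fun r => norm_nonneg _) ?_ hlim
      filter_upwards [hsmall.eventually_le_const one_pos, hσ_top.eventually_gt_atTop 0,
        eventually_ge_atTop 0] with r hr hs h0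
      have hb : 0 < S.secondMoment r := Real.sqrt_pos.1 hs
      have hsq : S.secondMoment r * (x / σ r) ^ 2 = x ^ 2 := by
        rw [div_pow, hσ]; simp only []; rw [Real.sq_sqrt hb.le]; field_simp
      have := Polynomial.norm_phase_add_le hn h0 hr
      rw [hsq] at this
      refine le_trans (le_of_eq ?_) this
      congr 1
      push_cast
      ring
    have h3 : Tendsto (fun r => f r (x / σ r)) atTop (nhds (Real.exp (-(1 / 2) * x ^ 2) : ℂ)) := by
      have h4 : Tendsto (fun r => Complex.exp (((t * (x / σ r) : ℝ) : ℂ) * Complex.I)) atTop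
          (nhds 1) := by
        have h5 : Continuous fun θ : ℝ => Complex.exp (((t * θ : ℝ) : ℂ) * Complex.I) := by fun_prop
        have h6 := (h5.tendsto 0).comp hθ
        rw [Function.comp_def] at h6
        convert h6 using 2
        simp
      have h7 := ((Complex.continuous_exp.tendsto _).comp h2).mul h4
      rw [mul_one] at h7
      convert h7 using 2
      · push_cast [hf]
        rfl
      · push_cast
        rfl
    refine h3.congr' ?_
    filter_upwards [h1] with r hr
    rw [Set.indicator_of_mem hr]

end

/-! ### Location and expansion of the saddle point -/

theorem ContDiffAt.exists_taylor_isLittleO {f : ℝ → ℝ} {n : ℕ} (hf : ContDiffAt ℝ n f 0) :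
    ∃ q : ℕ → ℝ, (fun x => f x - ∑ i ∈ Finset.range (n + 1), q i * x ^ i) =o[nhds 0]
      fun x => x ^ n := by
  obtain ⟨ε, hε, h⟩ := Metric.eventually_nhds_iff_ball.1 (hf.eventually (by simp))
  have h1 : ContDiffOn ℝ n f (Metric.ball 0 ε) := fun x hx => (h x hx).contDiffWithinAt
  have h2 := taylor_isLittleO (convex_ball _ _) (Metric.mem_ball_self hε) h1
  rw [Metric.isOpen_ball.nhdsWithin_eq (Metric.mem_ball_self hε)] at h2
  refine ⟨fun k => (k.factorial : ℝ)⁻¹ * iteratedDerivWithin k f (Metric.ball 0 ε) 0, ?_⟩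
  simp only [taylor_within_apply, sub_zero, smul_eq_mul] at h2
  refine h2.congr_left fun x => ?_
  congr 1
  exact Finset.sum_congr rfl fun i _ => by ring

/-- A function `w G(w)^e` with `G(0) > 0` has a smooth local inverse at `0`. -/
theorem exists_local_inverse_mul_rpow {G : ℝ → ℝ} {n : ℕ} (hn : n ≠ 0) (hG : ContDiffAt ℝ n G 0)
    (h0 : 0 < G 0) (e : ℝ) :
    ∃ ω : ℝ → ℝ, ContDiffAt ℝ n ω 0 ∧ ω 0 = 0 ∧ ∀ᶠ u in nhds 0, ω u * G (ω u) ^ e = u := by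
  have hn' : (n : WithTop ℕ∞) ≠ 0 := by exact_mod_cast hn
  have hg : ContDiffAt ℝ n (fun w => G w ^ e) 0 := hG.rpow_const_of_ne h0.ne'
  have hψ : ContDiffAt ℝ n (fun w => w * G w ^ e) 0 := contDiffAt_id.mul hg
  have hne : G 0 ^ e ≠ 0 := (Real.rpow_pos_of_pos h0 e).ne'
  have hd : HasDerivAt (fun w => w * G w ^ e) (G 0 ^ e) 0 := by
    exact ((hasDerivAt_id' (0 : ℝ)).fun_mul (hg.differentiableAt hn').hasDerivAt).congr_deriv
      (by simp)
  have hd' : HasFDerivAt (fun w => w * G w ^ e)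
      (ContinuousLinearEquiv.unitsEquivAut ℝ (Units.mk0 _ hne) : ℝ →L[ℝ] ℝ) 0 := by
    refine hd.hasFDerivAt.congr_fderiv ?_
    ext
    simp
  have h1 := hψ.to_localInverse hd' hn'
  have h2 := hψ.localInverse_apply_image hd' hn'
  have h3 := (hψ.hasStrictFDerivAt' hd' hn').eventually_right_inverse
  simp only [zero_mul] at h1 h2 h3
  exact ⟨_, h1, h2, h3⟩

/-- The polynomial `w^d S(1/w)`, as a function of the coefficients. -/
noncomputable def revEval (c : ℕ → ℝ) (d : ℕ) (w : ℝ) : ℝ :=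
  ∑ i ∈ Finset.range (d + 1), c i * w ^ (d - i)

theorem revEval_zero (c : ℕ → ℝ) (d : ℕ) : revEval c d 0 = c d := by
  rw [revEval, Finset.sum_range_succ, Finset.sum_eq_zero]
  · simp
  · intro i hi
    rw [zero_pow (by have := Finset.mem_range.1 hi; omega), mul_zero]

theorem contDiff_revEval (c : ℕ → ℝ) (d : ℕ) {n : WithTop ℕ∞} : ContDiff ℝ n (revEval c d) := by
  unfold revEval; fun_prop

theorem sum_mul_pow_eq_revEval (c : ℕ → ℝ) (d : ℕ) {w : ℝ} (hw : w ≠ 0) :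
    ∑ i ∈ Finset.range (d + 1), c i * w⁻¹ ^ i = w⁻¹ ^ d * revEval c d w := by
  rw [revEval, Finset.mul_sum]
  refine Finset.sum_congr rfl fun i hi => ?_
  have : d = i + (d - i) := by have := Finset.mem_range.1 hi; omega
  have h2 : w⁻¹ ^ d = w⁻¹ ^ i * w⁻¹ ^ (d - i) := by rw [← pow_add, ← this]
  rw [h2, inv_pow w (d - i)]
  field_simp

section
variable {S : ℝ[X]}

theorem Polynomial.firstMoment_inv (S : ℝ[X]) {w : ℝ} (hw : w ≠ 0) : S.firstMoment w⁻¹ =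
    w⁻¹ ^ S.natDegree * revEval (fun i => i * S.coeff i) S.natDegree w := by
  rw [← sum_mul_pow_eq_revEval _ _ hw, Polynomial.firstMoment]
  exact Finset.sum_congr rfl fun i _ => by ring

theorem Polynomial.secondMoment_inv (S : ℝ[X]) {w : ℝ} (hw : w ≠ 0) : S.secondMoment w⁻¹ =
    w⁻¹ ^ S.natDegree * revEval (fun i => i ^ 2 * S.coeff i) S.natDegree w := by
  rw [← sum_mul_pow_eq_revEval _ _ hw, Polynomial.secondMoment]
  exact Finset.sum_congr rfl fun i _ => by ring

theorem Polynomial.eval_inv_eq_revEval (S : ℝ[X]) {w : ℝ} (hw : w ≠ 0) : S.eval w⁻¹ =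
    w⁻¹ ^ S.natDegree * revEval S.coeff S.natDegree w := by
  rw [← sum_mul_pow_eq_revEval _ _ hw, eval_eq_sum_range]

/-- In w = 1/r the quotient is continuous at w = 0, with value d² s_d / (d s_d). -/
theorem Polynomial.tendsto_secondMoment_div_firstMoment (hS : AperiodicPoly S)
    (hn : ∀ i, 0 ≤ S.coeff i) :
    Tendsto (fun r => S.secondMoment r / S.firstMoment r) atTop (nhds S.natDegree) := by
  have hd : (0 : ℝ) < S.natDegree := by exact_mod_cast hS.natDegree_pos
  have hs := hS.coeff_natDegree_pos hn
  have h1 : Tendsto (fun w => revEval (fun i => i ^ 2 * S.coeff i) S.natDegree w /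
      revEval (fun i => i * S.coeff i) S.natDegree w) (nhds 0) (nhds S.natDegree) := by
    have h2 := ((contDiff_revEval (fun i => (i : ℝ) ^ 2 * S.coeff i) S.natDegree
      (n := 0)).continuous.tendsto 0).div ((contDiff_revEval (fun i => (i : ℝ) * S.coeff i)
      S.natDegree (n := 0)).continuous.tendsto 0)
      (by rw [revEval_zero]; positivity)
    rw [revEval_zero, revEval_zero] at h2
    convert h2 using 2
    · rfl
    · field_simp
  refine (h1.comp tendsto_inv_atTop_zero).congr' ?_
  filter_upwards [eventually_gt_atTop 0] with r hr
  have h3 := S.firstMoment_inv (inv_ne_zero hr.ne')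
  have h4 := S.secondMoment_inv (inv_ne_zero hr.ne')
  rw [inv_inv] at h3 h4
  rw [h3, h4, Function.comp_apply, mul_div_mul_left _ _ (by positivity)]

/-- Existence and asymptotic expansion of the saddle point. -/
theorem Polynomial.exists_saddle (hS : AperiodicPoly S) (hn : ∀ i, 0 ≤ S.coeff i) :
    ∃ T : ℝ[X], T.natDegree ≤ S.natDegree - 1 ∧ ∃ r : ℕ → ℝ, Tendsto r atTop atTop ∧
      (∀ᶠ n : ℕ in atTop, S.firstMoment (r n) = n) ∧
      Tendsto (fun n : ℕ => r n / (n : ℝ) ^ (1 / (S.natDegree : ℝ))) atTop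
        (nhds ((S.natDegree * S.coeff S.natDegree) ^ (-(1 / (S.natDegree : ℝ))))) ∧
      Tendsto (fun n : ℕ => S.eval (r n) - n * Real.log (r n) -
        ((n : ℝ) / S.natDegree * (1 + Real.log (S.natDegree * S.coeff S.natDegree)) -
          (n : ℝ) / S.natDegree * Real.log n + T.eval ((n : ℝ) ^ (1 / (S.natDegree : ℝ)))))
        atTop (nhds 0) := by
  set d := S.natDegree with hd_def
  have hd1 : 0 < d := hS.natDegree_pos
  have hd : (0 : ℝ) < d := by exact_mod_cast hd1
  have hs : 0 < S.coeff d := hS.coeff_natDegree_pos hn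
  set G := revEval (fun i => (i : ℝ) * S.coeff i) d with hG
  set H := revEval S.coeff d with hH
  have hG0 : G 0 = d * S.coeff d := revEval_zero _ _
  have hH0 : H 0 = S.coeff d := revEval_zero _ _
  have hGpos : 0 < G 0 := by rw [hG0]; positivity
  -- With w = 1/r, the equation r S'(r) = n reads w^d = G(w)/n, that is w G(w)^(-1/d) = n^(-1/d),
  -- which is smoothly invertible at 0.
  obtain ⟨ω, hω, hω0, hinv⟩ := exists_local_inverse_mul_rpow hd1.ne'
    (contDiff_revEval (fun i => (i : ℝ) * S.coeff i) d (n := d)).contDiffAt hGpos (-(1 / (d : ℝ)))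
  have hGω : ContDiffAt ℝ d (fun u => G (ω u)) 0 := (contDiff_revEval _ d).contDiffAt.comp 0 hω
  have hHω : ContDiffAt ℝ d (fun u => H (ω u)) 0 := (contDiff_revEval _ d).contDiffAt.comp 0 hω
  have hGω0 : G (ω 0) ≠ 0 := by rw [hω0]; exact hGpos.ne'
  -- This is (S(r) - n log r)/n with -(log n)/d removed: S(r) = n H/G and log w = (log G - log n)/d
  -- at the saddle.
  have hF : ContDiffAt ℝ d (fun u => H (ω u) / G (ω u) + 1 / d * Real.log (G (ω u))) 0 :=
    (hHω.div hGω hGω0).add (contDiffAt_const.mul (hGω.log hGω0))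
  obtain ⟨q, hq⟩ := hF.exists_taylor_isLittleO
  have hq0 : q 0 = 1 / d * (1 + Real.log (d * S.coeff d)) := by
    -- The little-o bound evaluated at 0 itself, where u^d = 0, forces equality there and so
    -- identifies the constant coefficient.
    have h1 := (hq.bound one_pos).self_of_nhds
    rw [zero_pow hd1.ne', norm_zero, mul_zero, norm_le_zero_iff, Finset.sum_range_succ',
      Finset.sum_eq_zero (fun i _ => by simp), hω0, hG0, hH0] at h1
    simp only [pow_zero, mul_one, zero_add] at h1
    have : S.coeff d / (d * S.coeff d) = 1 / d := by field_simp
    rw [this] at h1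
    linarith
  set u : ℕ → ℝ := fun n => ((n : ℝ) ^ (1 / (d : ℝ)))⁻¹ with hu
  have hx : Tendsto (fun n : ℕ => (n : ℝ) ^ (1 / (d : ℝ))) atTop atTop :=
    (tendsto_rpow_atTop (by positivity)).comp tendsto_natCast_atTop_atTop
  have hu0 : Tendsto u atTop (nhds 0) := tendsto_inv_atTop_zero.comp hx
  have hωu : Tendsto (fun n => ω (u n)) atTop (nhds 0) := by
    have := hω.continuousAt.tendsto.comp hu0
    rwa [hω0] at this
  have hGu : Tendsto (fun n => G (ω (u n))) atTop (nhds (d * S.coeff d)) := by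
    have := hGω.continuousAt.tendsto.comp hu0
    rwa [hω0, hG0] at this
  have hxd : ∀ n : ℕ, ((n : ℝ) ^ (1 / (d : ℝ))) ^ d = n := fun n => by
    rw [one_div, Real.rpow_inv_natCast_pow n.cast_nonneg hd1.ne']
  have hud : ∀ n : ℕ, u n ^ d = (n : ℝ)⁻¹ := fun n => by rw [← hxd n, ← inv_pow]
  have main : ∀ᶠ n : ℕ in atTop, 0 < (n : ℝ) ∧ 0 < ω (u n) ∧ 0 < G (ω (u n)) ∧
      ω (u n) = u n * G (ω (u n)) ^ (1 / (d : ℝ)) ∧ ω (u n) ^ d = (n : ℝ)⁻¹ * G (ω (u n)) := by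
    filter_upwards [eventually_gt_atTop 0, hu0.eventually hinv,
      hGu.eventually_const_lt (by positivity)] with n h1 h2 h3
    have hnpos : 0 < (n : ℝ) := by exact_mod_cast h1
    have h4 : 0 < G (ω (u n)) ^ (1 / (d : ℝ)) := Real.rpow_pos_of_pos h3 _
    have h5 : ω (u n) = u n * G (ω (u n)) ^ (1 / (d : ℝ)) := by
      nth_rw 2 [← h2]
      rw [mul_assoc, ← Real.rpow_add h3]
      simp
    have h6 : 0 < u n := inv_pos.2 (Real.rpow_pos_of_pos hnpos _)
    refine ⟨hnpos, h5 ▸ mul_pos h6 h4, h3, h5, ?_⟩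
    calc ω (u n) ^ d = (u n * G (ω (u n)) ^ (1 / (d : ℝ))) ^ d := congrArg (· ^ d) h5
      _ = _ := by rw [mul_pow, hud, one_div, Real.rpow_inv_natCast_pow h3.le hd1.ne']
  -- Since n u^i = x^(d-i) for x = n^(1/d), the coefficient of x^k is q (d - k). The term k = d,
  -- which is q 0 · n, belongs to the explicit main term.
  refine ⟨∑ k ∈ Finset.range d, monomial k (q (d - k)), ?_, fun n => (ω (u n))⁻¹, ?_, ?_, ?_, ?_⟩
  · refine natDegree_sum_le_of_forall_le _ _ fun k hk => (natDegree_monomial_le _).trans ?_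
    have := Finset.mem_range.1 hk
    omega
  · refine tendsto_inv_nhdsGT_zero.comp (tendsto_nhdsWithin_iff.2 ⟨hωu, ?_⟩)
    exact main.mono fun n h => h.2.1
  · filter_upwards [main] with n ⟨h1, h2, h3, h4, h5⟩
    rw [S.firstMoment_inv h2.ne', ← hd_def, ← hG]
    rw [inv_pow, h5]
    field_simp
  · rw [Real.rpow_neg (by positivity)]
    have h1 := (hGu.rpow_const (p := 1 / (d : ℝ)) (Or.inl (by positivity))).inv₀
      (Real.rpow_pos_of_pos (by positivity) _).ne'
    refine h1.congr' ?_
    filter_upwards [main] with n ⟨h1, h2, h3, h4, _⟩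
    have h5 : (n : ℝ) ^ (1 / (d : ℝ)) ≠ 0 := (Real.rpow_pos_of_pos h1 _).ne'
    have h6 : G (ω (u n)) ^ (1 / (d : ℝ)) ≠ 0 := (Real.rpow_pos_of_pos h3 _).ne'
    rw [eq_div_iff h5]
    nth_rw 2 [h4]
    rw [hu]
    field_simp
  · have h1 := hq.comp_tendsto hu0
    have h2 : Tendsto (fun n : ℕ => ((fun x => H (ω x) / G (ω x) + 1 / d * Real.log (G (ω x)) -
        ∑ i ∈ Finset.range (d + 1), q i * x ^ i) ∘ u) n / ((fun x => x ^ d) ∘ u) n)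
        atTop (nhds 0) := h1.tendsto_div_nhds_zero
    refine h2.congr' ?_
    filter_upwards [main] with n ⟨hn0, hw, hGp, hwu, hwd⟩
    set x := (n : ℝ) ^ (1 / (d : ℝ)) with hx_def
    have hxpos : 0 < x := Real.rpow_pos_of_pos hn0 _
    have hux : u n = x⁻¹ := rfl
    have hGr : 0 < G (ω (u n)) ^ (1 / (d : ℝ)) := Real.rpow_pos_of_pos hGp _
    have hlogx : Real.log x = 1 / d * Real.log n := Real.log_rpow hn0 _
    have hlog : Real.log (ω (u n)) = -(1 / d * Real.log n) + 1 / d * Real.log (G (ω (u n))) := by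
      conv_lhs => rw [hwu]
      rw [Real.log_mul (by rw [hux]; positivity) hGr.ne', Real.log_rpow hGp, hux, Real.log_inv,
        hlogx]
    have hT : (∑ k ∈ Finset.range d, monomial k (q (d - k))).eval x + q 0 * n =
        n * ∑ i ∈ Finset.range (d + 1), q i * u n ^ i := by
      rw [eval_finsetSum, ← Finset.sum_range_reflect, Finset.sum_range_succ', mul_add,
        pow_zero, mul_one, mul_comm (n : ℝ) (q 0), Finset.mul_sum]
      congr 1
      refine Finset.sum_congr rfl fun k hk => ?_
      have hk := Finset.mem_range.1 hk
      rw [eval_monomial, hux, show d - (d - 1 - k) = k + 1 by omega, ← hxd n, ← hx_def]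
      have : x ^ d = x ^ (k + 1) * x ^ (d - 1 - k) := by rw [← pow_add]; congr 1; omega
      rw [this, inv_pow]
      field_simp
    rw [S.eval_inv_eq_revEval hw.ne', ← hd_def, ← hH, Real.log_inv, hlog, inv_pow, hwd]
    simp only [Function.comp_apply]
    rw [hud, div_inv_eq_mul,
      eq_sub_of_add_eq hT, hq0]
    field_simp
    ring
end

/-! ### Asymptotics of the coefficients and their ratios -/

section
variable {S : ℝ[X]}

theorem Polynomial.phase_eq (S : ℝ[X]) (r θ : ℝ) : S.phase r θ =
    (S.map Complex.ofRealHom).eval (r * Complex.exp (θ * Complex.I)) - (S.eval r : ℝ) -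
      S.firstMoment r * (θ * Complex.I) := by
  rw [eval_map, eval₂_eq_sum_range, eval_eq_sum_range, Polynomial.firstMoment, Polynomial.phase,
    Complex.ofReal_sum, Complex.ofReal_sum, Finset.sum_mul, ← Finset.sum_sub_distrib,
    ← Finset.sum_sub_distrib]
  refine Finset.sum_congr rfl fun i _ => ?_
  rw [mul_pow, ← Complex.exp_nat_mul]
  push_cast
  rw [Complex.ofRealHom_eq_coe, mul_assoc (i : ℂ)]
  ring

/-- At the saddle for n, the factor e^(itθ) turns e^(-inθ) into e^(-i(n-t)θ), so one radius serves
all shifts t. -/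
theorem integral_exp_phase (h0 : S.coeff 0 = 0) {r : ℝ} {n t : ℕ} (ht : t ≤ n)
    (hr : S.firstMoment r = n) :
    ∫ θ in (-Real.pi)..Real.pi,
      Complex.exp (S.phase r θ) * Complex.exp (((t * θ : ℝ) : ℂ) * Complex.I) =
    ((2 * Real.pi * (PowerSeries.coeff (n - t) (expSeries S) * r ^ (n - t) *
      Real.exp (-S.eval r)) : ℝ) : ℂ) := by
  have e : ∀ θ : ℝ, Complex.exp (S.phase r θ) * Complex.exp (((t * θ : ℝ) : ℂ) * Complex.I) =
      Complex.exp ((S.map Complex.ofRealHom).eval (r * Complex.exp (θ * Complex.I))) *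
        Complex.exp (-((n - t : ℕ) * (θ * Complex.I))) * Real.exp (-S.eval r) := by
    intro θ
    rw [Complex.ofReal_exp, ← Complex.exp_add, ← Complex.exp_add, ← Complex.exp_add,
      Polynomial.phase_eq, hr, Nat.cast_sub ht]
    congr 1
    push_cast
    ring
  simp_rw [e]
  rw [intervalIntegral.integral_mul_const, integral_exp_eval_circle h0]
  push_cast
  ring

/-- Saddle point asymptotics of the coefficients of `exp S`. -/
theorem tendsto_coeff_expSeries_saddle (h0 : S.coeff 0 = 0) (hn : ∀ i, 0 ≤ S.coeff i)
    (hS : AperiodicPoly S) {r : ℕ → ℝ} (hr : Tendsto r atTop atTop)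
    (hfm : ∀ᶠ n : ℕ in atTop, S.firstMoment (r n) = n) (t : ℕ) :
    Tendsto (fun n : ℕ => PowerSeries.coeff (n - t) (expSeries S) * r n ^ (n - t) *
      Real.exp (-S.eval (r n)) * √(2 * Real.pi * S.secondMoment (r n))) atTop (nhds 1) := by
  have h1 := (Polynomial.tendsto_integral_exp_phase hS hn t).comp hr
  have h2 : Tendsto (fun n : ℕ => √(S.secondMoment (r n)) * (2 * Real.pi *
      (PowerSeries.coeff (n - t) (expSeries S) * r n ^ (n - t) *
      Real.exp (-S.eval (r n))))) atTop (nhds √(2 * Real.pi)) := by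
    rw [← tendsto_ofReal_iff]
    refine h1.congr' ?_
    filter_upwards [hfm, eventually_ge_atTop t] with n hn ht
    rw [Function.comp_apply, integral_exp_phase h0 ht hn]
    push_cast
    rfl
  have hpos : √(2 * Real.pi) ≠ 0 := (Real.sqrt_pos.2 (by positivity)).ne'
  have h3 := h2.div_const √(2 * Real.pi)
  rw [div_self hpos] at h3
  refine h3.congr fun n => ?_
  rw [Real.sqrt_mul (by positivity : (0 : ℝ) ≤ 2 * Real.pi) (S.secondMoment _),
    div_eq_iff hpos]
  have := Real.mul_self_sqrt (by positivity : (0:ℝ) ≤ 2 * Real.pi)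
  linear_combination (-√(S.secondMoment (r n)) * (PowerSeries.coeff (n - t) (expSeries S) *
    r n ^ (n - t) * Real.exp (-S.eval (r n)))) * this

theorem eventually_coeff_expSeries_pos (h0 : S.coeff 0 = 0) (hn : ∀ i, 0 ≤ S.coeff i)
    (hS : AperiodicPoly S) : ∀ᶠ n : ℕ in atTop, 0 < PowerSeries.coeff n (expSeries S) := by
  obtain ⟨T, -, r, hr, hfm, -, -⟩ := Polynomial.exists_saddle hS hn
  filter_upwards [(tendsto_coeff_expSeries_saddle h0 hn hS hr hfm 0).eventually_const_lt one_pos]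
    with n h
  refine (coeff_expSeries_nonneg h0 hn n).lt_of_ne fun h' => ?_
  rw [Nat.sub_zero, ← h'] at h
  simp at h

theorem tendsto_secondMoment_div_natCast (hn : ∀ i, 0 ≤ S.coeff i)
    (hS : AperiodicPoly S) {r : ℕ → ℝ} (hr : Tendsto r atTop atTop)
    (hfm : ∀ᶠ n : ℕ in atTop, S.firstMoment (r n) = n) :
    Tendsto (fun n : ℕ => S.secondMoment (r n) / n) atTop (nhds S.natDegree) := by
  refine ((Polynomial.tendsto_secondMoment_div_firstMoment hS hn).comp hr).congr' ?_
  filter_upwards [hfm] with n h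
  rw [Function.comp_apply, h]

theorem exists_isEquivalent_coeff_expSeries (h0 : S.coeff 0 = 0) (hn : ∀ i, 0 ≤ S.coeff i)
    (hS : AperiodicPoly S) :
    ∃ T : ℝ[X], T.natDegree ≤ S.natDegree - 1 ∧
      (fun n : ℕ => PowerSeries.coeff n (expSeries S)) ~[atTop]
        fun n : ℕ => 1 / Real.sqrt (2 * Real.pi * S.natDegree * n) *
          (n : ℝ) ^ (-((n : ℝ) / S.natDegree)) *
          Real.exp ((n : ℝ) / S.natDegree * (1 + Real.log (S.natDegree * S.coeff S.natDegree)) +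
            T.eval ((n : ℝ) ^ (1 / (S.natDegree : ℝ)))) := by
  obtain ⟨T, hT, r, hr, hfm, -, hexp⟩ := Polynomial.exists_saddle hS hn
  have hd : (0 : ℝ) < S.natDegree := by exact_mod_cast hS.natDegree_pos
  refine ⟨T, hT, isEquivalent_of_tendsto_one ?_⟩
  have h1 := tendsto_coeff_expSeries_saddle h0 hn hS hr hfm 0
  have h2 := (Real.continuous_exp.tendsto 0).comp hexp
  -- The correction √(d n / b), tending to 1, replaces b(r_n) by d n under the root.
  have h3 := ((tendsto_secondMoment_div_natCast hn hS hr hfm).inv₀ hd.ne').const_mul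
    (S.natDegree : ℝ) |>.sqrt
  have h4 := (h1.mul h2).mul h3
  rw [mul_inv_cancel₀ hd.ne', Real.exp_zero, Real.sqrt_one, mul_one, mul_one] at h4
  refine h4.congr' ?_
  filter_upwards [hr.eventually_gt_atTop 0, eventually_gt_atTop 0,
    hr.eventually ((Polynomial.tendsto_secondMoment hS hn).eventually_gt_atTop 0)] with n hrn hn0 hb
  have hn0' : (0 : ℝ) < n := by exact_mod_cast hn0
  rw [Pi.div_apply, Nat.sub_zero, Function.comp_apply, Real.rpow_def_of_pos hn0' (-(_ / _)),
    eq_div_iff (by positivity)]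
  set E := (n : ℝ) / S.natDegree * (1 + Real.log (S.natDegree * S.coeff S.natDegree))
  set b := S.secondMoment (r n)
  have e1 : √(2 * Real.pi * b) * √(S.natDegree * (b / n)⁻¹) *
      (1 / √(2 * Real.pi * S.natDegree * n)) = 1 := by
    rw [← Real.sqrt_mul (by positivity), mul_one_div, ← Real.sqrt_div (by positivity),
      Real.sqrt_eq_one]
    field_simp
  have e2 : r n ^ n * Real.exp (-S.eval (r n)) * Real.exp (S.eval (r n) - n * Real.log (r n) -
      (E - (n : ℝ) / S.natDegree * Real.log n + T.eval ((n : ℝ) ^ (1 / (S.natDegree : ℝ))))) *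
      (Real.exp (Real.log n * -(n / S.natDegree)) *
        Real.exp (E + T.eval ((n : ℝ) ^ (1 / (S.natDegree : ℝ))))) = 1 := by
    nth_rw 1 [← Real.exp_log hrn]
    rw [← Real.exp_nat_mul, ← Real.exp_add, ← Real.exp_add, ← Real.exp_add, ← Real.exp_add,
      ← Real.exp_zero]
    congr 1
    ring
  linear_combination (PowerSeries.coeff n (expSeries S) *
    (√(2 * Real.pi * b) * √(S.natDegree * (b / n)⁻¹) *
      (1 / √(2 * Real.pi * S.natDegree * n)))) * e2 + PowerSeries.coeff n (expSeries S) * e1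

/-- Both coefficients are estimated at the same radius r_n, so everything cancels except r_n^t. -/
theorem tendsto_coeff_expSeries_ratio (h0 : S.coeff 0 = 0) (hn : ∀ i, 0 ≤ S.coeff i)
    (hS : AperiodicPoly S) (t : ℕ) :
    Tendsto (fun n : ℕ => PowerSeries.coeff (n - t) (expSeries S) /
      PowerSeries.coeff n (expSeries S) / (n : ℝ) ^ ((t : ℝ) / S.natDegree)) atTop
      (nhds ((S.natDegree * S.coeff S.natDegree) ^ (-((t : ℝ) / S.natDegree)))) := by
  obtain ⟨T, -, r, hr, hfm, hlim, -⟩ := Polynomial.exists_saddle hS hn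
  have hd : (0 : ℝ) < S.natDegree := by exact_mod_cast hS.natDegree_pos
  have hs := hS.coeff_natDegree_pos hn
  have h1 := ((tendsto_coeff_expSeries_saddle h0 hn hS hr hfm t).div
    (tendsto_coeff_expSeries_saddle h0 hn hS hr hfm 0) one_ne_zero).mul (hlim.pow t)
  have e : (1 : ℝ) / 1 * ((S.natDegree * S.coeff S.natDegree) ^ (-(1 / (S.natDegree : ℝ)))) ^ t =
      (S.natDegree * S.coeff S.natDegree) ^ (-((t : ℝ) / S.natDegree)) := by
    rw [← Real.rpow_mul_natCast (by positivity)]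
    ring_nf
  rw [e] at h1
  refine h1.congr' ?_
  filter_upwards [hr.eventually_gt_atTop 0, eventually_gt_atTop 0, eventually_ge_atTop t,
    hr.eventually ((Polynomial.tendsto_secondMoment hS hn).eventually_gt_atTop 0),
    eventually_coeff_expSeries_pos h0 hn hS] with n hrn hn0 ht hb ha
  have hn0' : (0 : ℝ) < n := by exact_mod_cast hn0
  have e2 : (n : ℝ) ^ ((t : ℝ) / S.natDegree) = ((n : ℝ) ^ (1 / (S.natDegree : ℝ))) ^ t := by
    rw [← Real.rpow_mul_natCast (by positivity)]
    ring_nf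
  have e3 : r n ^ n = r n ^ (n - t) * r n ^ t := by rw [← pow_add, Nat.sub_add_cancel ht]
  have e4 : √(2 * Real.pi * S.secondMoment (r n)) ≠ 0 := (Real.sqrt_pos.2 (by positivity)).ne'
  have e5 : (n : ℝ) ^ (1 / (S.natDegree : ℝ)) ≠ 0 := (Real.rpow_pos_of_pos hn0' _).ne'
  rw [Pi.div_apply, e2, Nat.sub_zero, e3, div_pow]
  have := Real.exp_pos (-S.eval (r n))
  field_simp

/-- The polynomial `S` with its coefficient of index `t` multiplied by `w`. -/
noncomputable def Polynomial.scaleCoeff (S : ℝ[X]) (t : ℕ) (w : ℝ) : ℝ[X] :=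
  S + monomial t ((w - 1) * S.coeff t)

theorem Polynomial.coeff_scaleCoeff (S : ℝ[X]) (t : ℕ) (w : ℝ) (i : ℕ) :
    (S.scaleCoeff t w).coeff i = (if i = t then w else 1) * S.coeff i := by
  rw [Polynomial.scaleCoeff, coeff_add, coeff_monomial]
  by_cases h : i = t
  · subst h; simp; ring
  · rw [if_neg h, if_neg (Ne.symm h)]; ring

/-- The trivial bound for the scaled polynomial is taken at the saddle r_n of S, where its value
exceeds S(r_n) by (w-1) s_t r_n^t. Compared with the true size of [z^n] exp S it loses only a factor
of order √b(r_n), absorbed by the strict inequality for y. -/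
theorem eventually_coeff_expSeries_scaleCoeff_le (h0 : S.coeff 0 = 0) (hn : ∀ i, 0 ≤ S.coeff i)
    (hS : AperiodicPoly S) {t : ℕ} (ht : 0 < t) {w : ℝ} (hw : 0 ≤ w) {y : ℝ}
    (hy : (w - 1) * (S.coeff t *
      (S.natDegree * S.coeff S.natDegree) ^ (-((t : ℝ) / S.natDegree))) < y) :
    ∀ᶠ n : ℕ in atTop, PowerSeries.coeff n (expSeries (S.scaleCoeff t w)) ≤
      PowerSeries.coeff n (expSeries S) * Real.exp (y * (n : ℝ) ^ ((t : ℝ) / S.natDegree)) := by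
  obtain ⟨T, -, r, hr, hfm, hlim, -⟩ := Polynomial.exists_saddle hS hn
  have hd : (0 : ℝ) < S.natDegree := by exact_mod_cast hS.natDegree_pos
  have hs := hS.coeff_natDegree_pos hn
  set e := (t : ℝ) / S.natDegree with he
  have hepos : 0 < e := by positivity
  have hpow : Tendsto (fun n : ℕ => (n : ℝ) ^ e) atTop atTop :=
    (tendsto_rpow_atTop hepos).comp tendsto_natCast_atTop_atTop
  have hlog : Tendsto (fun n : ℕ => Real.log n / (n : ℝ) ^ e) atTop (nhds 0) :=
    (isLittleO_log_rpow_atTop hepos).tendsto_div_nhds_zero.comp tendsto_natCast_atTop_atTop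
  have hb := tendsto_secondMoment_div_natCast hn hS hr hfm
  have h1 : Tendsto (fun n : ℕ => (Real.log 2 + 1 / 2 * (Real.log (2 * Real.pi) +
      Real.log (S.secondMoment (r n) / n))) / (n : ℝ) ^ e) atTop (nhds 0) :=
    Tendsto.div_atTop (((hb.log hd.ne').const_add _).const_mul _ |>.const_add _) hpow
  have h2 : Tendsto (fun n : ℕ => (w - 1) * (S.coeff t * (r n ^ t / (n : ℝ) ^ e))) atTop
      (nhds ((w - 1) * (S.coeff t * (S.natDegree * S.coeff S.natDegree) ^ (-e)))) := by
    have h3 := ((hlim.pow t).const_mul (S.coeff t)).const_mul (w - 1)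
    have e1 : ((S.natDegree * S.coeff S.natDegree) ^ (-(1 / (S.natDegree : ℝ)))) ^ t =
        (S.natDegree * S.coeff S.natDegree) ^ (-e) := by
      rw [← Real.rpow_mul_natCast (by positivity), he]
      ring_nf
    rw [e1] at h3
    refine h3.congr fun n => ?_
    rw [div_pow, ← Real.rpow_mul_natCast (by positivity), he]
    ring_nf
  have h3 := (h1.add (hlog.const_mul (1 / 2))).add h2
  rw [mul_zero, add_zero, zero_add] at h3
  have hsc0 : (S.scaleCoeff t w).coeff 0 = 0 := by
    rw [Polynomial.coeff_scaleCoeff, h0, mul_zero]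
  have hscn : ∀ i, 0 ≤ (S.scaleCoeff t w).coeff i := fun i => by
    rw [Polynomial.coeff_scaleCoeff]
    refine mul_nonneg ?_ (hn i)
    split_ifs
    · exact hw
    · norm_num
  filter_upwards [hr.eventually_gt_atTop 0, eventually_gt_atTop 0, h3.eventually_lt_const hy,
    hr.eventually ((Polynomial.tendsto_secondMoment hS hn).eventually_gt_atTop 0),
    -- Any constant below the limit 1 would do; 1/2 is the source of the factor 2 below.
    (tendsto_coeff_expSeries_saddle h0 hn hS hr hfm 0).eventually_const_lt
      (by norm_num : (1 / 2 : ℝ) < 1)] with n hrn hn0 hlt hb ha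
  have hn0' : (0 : ℝ) < n := by exact_mod_cast hn0
  have hne : 0 < (n : ℝ) ^ e := Real.rpow_pos_of_pos hn0' _
  rw [Nat.sub_zero] at ha
  have h4 := coeff_expSeries_mul_pow_le hsc0 hscn hrn.le n
  have h5 : (S.scaleCoeff t w).eval (r n) = S.eval (r n) + (w - 1) * S.coeff t * r n ^ t := by
    rw [Polynomial.scaleCoeff, eval_add, eval_monomial]
  have hsq : 2 * √(2 * Real.pi * S.secondMoment (r n)) = Real.exp (Real.log 2 + 1 / 2 *
      (Real.log (2 * Real.pi) + Real.log (S.secondMoment (r n) / n)) + 1 / 2 * Real.log n) := by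
    rw [← Real.exp_log (by positivity : 0 < 2 * √(2 * Real.pi * S.secondMoment (r n)))]
    congr 1
    rw [Real.log_mul (by norm_num) (Real.sqrt_pos.2 (by positivity)).ne',
      Real.log_sqrt (by positivity),
      Real.log_mul (by positivity) hb.ne', Real.log_div hb.ne' hn0'.ne']
    ring
  have h6 : 2 * √(2 * Real.pi * S.secondMoment (r n)) *
      Real.exp ((w - 1) * S.coeff t * r n ^ t) ≤ Real.exp (y * (n : ℝ) ^ e) := by
    rw [hsq, ← Real.exp_add, Real.exp_le_exp]
    have := mul_le_mul_of_nonneg_right hlt.le hne.le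
    refine le_trans (le_of_eq ?_) this
    field_simp
  have h7 : 1 ≤ PowerSeries.coeff n (expSeries S) * r n ^ n * Real.exp (-S.eval (r n)) *
      (2 * √(2 * Real.pi * S.secondMoment (r n))) := by linarith
  have hrpow : 0 < r n ^ n := by positivity
  rw [← mul_le_mul_iff_left₀ hrpow]
  have ha0 := coeff_expSeries_nonneg h0 hn n
  calc _ ≤ Real.exp (S.eval (r n) + (w - 1) * S.coeff t * r n ^ t) := by rw [← h5]; exact h4
    _ = 1 * Real.exp (S.eval (r n)) * Real.exp ((w - 1) * S.coeff t * r n ^ t) := by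
      rw [Real.exp_add, one_mul]
    _ ≤ _ := by
      refine mul_le_mul_of_nonneg_right (mul_le_mul_of_nonneg_right h7 (Real.exp_pos _).le)
        (Real.exp_pos _).le
    _ = PowerSeries.coeff n (expSeries S) * (2 * √(2 * Real.pi * S.secondMoment (r n)) *
      Real.exp ((w - 1) * S.coeff t * r n ^ t)) * r n ^ n := by
      rw [Real.exp_neg]
      field_simp
    _ ≤ _ := by gcongr
end

/-! ### The exponential formula for weighted set structures -/

section
variable {V 𝒮 : Type*} [DecidableEq V] {size : 𝒮 → ℕ}

/-- `P` is a set of structures whose label sets partition `A`. -/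
structure IsSetStructureOn (size : 𝒮 → ℕ) (A : Finset V) (P : Finset (Finset V × 𝒮)) : Prop where
  card_eq : ∀ c ∈ P, c.1.card = size c.2
  disjoint : ∀ c ∈ P, ∀ c' ∈ P, c ≠ c' → Disjoint c.1 c'.1
  biUnion_eq : P.biUnion Prod.fst = A

theorem IsSetStructureOn.subset {A : Finset V} {P : Finset (Finset V × 𝒮)}
    (h : IsSetStructureOn size A P) {c : Finset V × 𝒮} (hc : c ∈ P) : c.1 ⊆ A := by
  rw [← h.biUnion_eq]
  exact Finset.subset_biUnion_of_mem Prod.fst hc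

theorem IsSetStructureOn.erase [DecidableEq 𝒮] {A : Finset V} {P : Finset (Finset V × 𝒮)}
    (h : IsSetStructureOn size A P) {c : Finset V × 𝒮} (hc : c ∈ P) :
    IsSetStructureOn size (A \ c.1) (P.erase c) where
  card_eq c' hc' := h.card_eq c' (Finset.mem_of_mem_erase hc')
  disjoint c₁ h₁ c₂ h₂ := h.disjoint c₁ (Finset.mem_of_mem_erase h₁) c₂ (Finset.mem_of_mem_erase h₂)
  biUnion_eq := by
    rw [← h.biUnion_eq]
    ext i
    simp only [Finset.mem_biUnion, Finset.mem_erase, Finset.mem_sdiff]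
    constructor
    · rintro ⟨c', ⟨hne, hc'⟩, hi⟩
      exact ⟨⟨c', hc', hi⟩, Finset.disjoint_left.1 (h.disjoint c' hc' c hc hne) hi⟩
    · rintro ⟨⟨c', hc', hi⟩, hni⟩
      exact ⟨c', ⟨fun e => hni (e ▸ hi), hc'⟩, hi⟩

/-- Positive size gives c a label, and that label lies outside A \ c.1. This makes inserting and
then erasing c the identity. -/
theorem IsSetStructureOn.notMem_of_sdiff (hpos : ∀ σ, 0 < size σ) {A : Finset V}
    {P : Finset (Finset V × 𝒮)} {c : Finset V × 𝒮} (hcard : c.1.card = size c.2)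
    (h : IsSetStructureOn size (A \ c.1) P) : c ∉ P := by
  intro hc
  obtain ⟨i, hi⟩ := Finset.card_pos.1 (hcard ▸ hpos c.2)
  exact (Finset.mem_sdiff.1 (h.subset hc hi)).2 hi

theorem IsSetStructureOn.insert [DecidableEq 𝒮] {A : Finset V} {P : Finset (Finset V × 𝒮)}
    {c : Finset V × 𝒮} (hcA : c.1 ⊆ A) (hcard : c.1.card = size c.2) (h : IsSetStructureOn size (A \ c.1) P) :
    IsSetStructureOn size A (insert c P) where
  card_eq c' hc' := by
    rcases Finset.mem_insert.1 hc' with rfl | hc'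
    · exact hcard
    · exact h.card_eq c' hc'
  disjoint := by
    have hd : ∀ c' ∈ P, Disjoint c.1 c'.1 := fun c' hc' =>
      Finset.disjoint_left.2 fun i hi hi' => (Finset.mem_sdiff.1 (h.subset hc' hi')).2 hi
    intro c₁ h₁ c₂ h₂ hne
    rcases Finset.mem_insert.1 h₁ with rfl | h₁' <;> rcases Finset.mem_insert.1 h₂ with rfl | h₂'
    · exact (hne rfl).elim
    · exact hd _ h₂'
    · exact (hd _ h₁').symm
    · exact h.disjoint _ h₁' _ h₂' hne
  biUnion_eq := by
    rw [Finset.biUnion_insert, h.biUnion_eq, Finset.union_sdiff_of_subset hcA]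

theorem IsSetStructureOn.sum_size {A : Finset V} {P : Finset (Finset V × 𝒮)}
    (h : IsSetStructureOn size A P) : ∑ c ∈ P, size c.2 = A.card := by
  rw [← h.biUnion_eq, Finset.card_biUnion h.disjoint]
  exact Finset.sum_congr rfl fun c hc => (h.card_eq c hc).symm

variable [Fintype V] [Fintype 𝒮]

open Classical in
/-- The finite set of all sets of structures with label set `A`. -/
noncomputable def setStructuresOn (size : 𝒮 → ℕ) (A : Finset V) :
    Finset (Finset (Finset V × 𝒮)) :=
  Finset.univ.filter (IsSetStructureOn size A)

theorem mem_setStructuresOn {A : Finset V} {P : Finset (Finset V × 𝒮)} :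
    P ∈ setStructuresOn size A ↔ IsSetStructureOn size A P := by
  simp [setStructuresOn]

/-- The number of sets of structures with label set `A`, each component of size `k` being counted
with weight `y k`. -/
noncomputable def weightedCount (size : 𝒮 → ℕ) (y : ℕ → ℝ) (A : Finset V) : ℝ :=
  ∑ P ∈ setStructuresOn size A, ∏ c ∈ P, y (size c.2)

/-- Removing the marked component is a bijection onto triples of a structure, its label set B, and a
set structure on A \ B. Arbitrary label sets A are used so that this removal stays within the
framework. -/
theorem sum_marked_component [DecidableEq 𝒮] (hpos : ∀ σ, 0 < size σ) (g y : ℕ → ℝ) (A : Finset V) :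
    ∑ P ∈ setStructuresOn size A, ∑ c ∈ P, g (size c.2) * ∏ c' ∈ P.erase c, y (size c'.2) =
      ∑ σ : 𝒮, ∑ B ∈ A.powersetCard (size σ), g (size σ) * weightedCount size y (A \ B) := by
  simp_rw [weightedCount, Finset.mul_sum]
  rw [Finset.sum_sigma']
  simp_rw [Finset.sum_sigma']
  refine Finset.sum_bij'
    (fun x _ => ⟨x.2.2, ⟨x.2.1, x.1.erase x.2⟩⟩)
    (fun x _ => ⟨insert (x.2.1, x.1) x.2.2, (x.2.1, x.1)⟩) ?_ ?_ ?_ ?_ ?_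
  · rintro ⟨P, c⟩ h
    simp only [Finset.mem_sigma, mem_setStructuresOn, Finset.mem_univ, true_and,
      Finset.mem_powersetCard] at h ⊢
    exact ⟨⟨h.1.subset h.2, h.1.card_eq c h.2⟩, h.1.erase h.2⟩
  · rintro ⟨σ, B, P⟩ h
    simp only [Finset.mem_sigma, mem_setStructuresOn, Finset.mem_univ, true_and,
      Finset.mem_powersetCard] at h ⊢
    exact ⟨h.2.insert (c := (B, σ)) h.1.1 h.1.2, Finset.mem_insert_self _ _⟩
  · rintro ⟨P, c⟩ h
    simp only [Finset.mem_sigma] at h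
    simp [Finset.insert_erase h.2]
  · rintro ⟨σ, B, P⟩ h
    simp only [Finset.mem_sigma, mem_setStructuresOn, Finset.mem_univ, true_and,
      Finset.mem_powersetCard] at h
    simp [Finset.erase_insert (h.2.notMem_of_sdiff hpos (c := (B, σ)) h.1.2)]
  · rintro ⟨P, c⟩ h
    rfl

theorem weightedCount_empty (hpos : ∀ σ, 0 < size σ) (y : ℕ → ℝ) :
    weightedCount size y (∅ : Finset V) = 1 := by
  have : setStructuresOn size (∅ : Finset V) = {∅} := by
    ext P
    rw [mem_setStructuresOn, Finset.mem_singleton]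
    constructor
    · intro h
      refine Finset.eq_empty_of_forall_notMem fun c hc => ?_
      have h1 := h.card_eq c hc
      rw [Finset.subset_empty.1 (h.subset hc), Finset.card_empty] at h1
      exact (hpos c.2).ne h1
    · rintro rfl
      exact ⟨by simp, by simp, by simp⟩
  simp [weightedCount, this]

/-- The component sizes add up to |A|, so marking a component with weight its size counts each set
structure |A| times: the combinatorial form of z F' = z S' F. -/
theorem card_mul_weightedCount [DecidableEq 𝒮] (hpos : ∀ σ, 0 < size σ) (y : ℕ → ℝ) (A : Finset V) :
    (A.card : ℝ) * weightedCount size y A =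
      ∑ σ : 𝒮, ∑ B ∈ A.powersetCard (size σ),
        (size σ * y (size σ)) * weightedCount size y (A \ B) := by
  rw [← sum_marked_component hpos (fun k => k * y k), weightedCount, Finset.mul_sum]
  refine Finset.sum_congr rfl fun P hP => ?_
  rw [← (mem_setStructuresOn.1 hP).sum_size, Nat.cast_sum, Finset.sum_mul]
  refine Finset.sum_congr rfl fun c hc => ?_
  rw [mul_assoc, Finset.mul_prod_erase P (fun c => y (size c.2)) hc]

end

theorem coeff_zero_expSeries {S : ℝ[X]} (h0 : S.coeff 0 = 0) :
    PowerSeries.coeff 0 (expSeries S) = 1 := by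
  refine (hasSum_coeff_expSeries h0 0).unique ?_
  convert hasSum_single (f := fun k : ℕ => (S ^ k).coeff 0 / (k.factorial : ℝ)) 0 ?_
  · simp
  · intro k hk
    rw [coeff_zero_eq_eval_zero, eval_pow, ← coeff_zero_eq_eval_zero, h0, zero_pow hk, zero_div]

section
variable {𝒮 : Type*} [Fintype 𝒮]

/-- The generating polynomial `∑_σ y(|σ|) z^|σ| / |σ|!`. -/
noncomputable def weightedEgs (size : 𝒮 → ℕ) (y : ℕ → ℝ) : ℝ[X] :=
  ∑ σ : 𝒮, monomial (size σ) (y (size σ) / (Nat.factorial (size σ) : ℝ))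

theorem coeff_weightedEgs_zero {size : 𝒮 → ℕ} (hpos : ∀ σ, 0 < size σ) (y : ℕ → ℝ) :
    (weightedEgs size y).coeff 0 = 0 := by
  rw [weightedEgs, finsetSum_coeff]
  exact Finset.sum_eq_zero fun σ _ => by rw [coeff_monomial, if_neg (hpos σ).ne']

/-- Compare coefficients in z (exp S)' = z S' exp S. This is the analytic counterpart of the
recursion for weighted counts. -/
theorem natCast_mul_coeff_expSeries {size : 𝒮 → ℕ} (hpos : ∀ σ, 0 < size σ) (y : ℕ → ℝ) (n : ℕ) :
    (n : ℝ) * PowerSeries.coeff n (expSeries (weightedEgs size y)) =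
      ∑ σ : 𝒮, if size σ ≤ n then
        (size σ * (y (size σ) / (Nat.factorial (size σ) : ℝ))) *
          PowerSeries.coeff (n - size σ) (expSeries (weightedEgs size y)) else 0 := by
  set S := weightedEgs size y with hS
  have hd : PowerSeries.derivative ℝ (expSeries S) = expSeries S * (derivative S : ℝ[X]) := by
    rw [expSeries, PowerSeries.derivative_subst (hasSubst_of_coeff_zero
      (coeff_weightedEgs_zero hpos y)), PowerSeries.derivative_exp, PowerSeries.derivative_coe]
  have h1 : (n : ℝ) * PowerSeries.coeff n (expSeries S) =
      PowerSeries.coeff n (PowerSeries.X * PowerSeries.derivative ℝ (expSeries S)) := by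
    cases n with
    | zero => simp
    | succ n => rw [PowerSeries.coeff_succ_X_mul, PowerSeries.coeff_derivative]; push_cast; ring
  have h2 : X * derivative S = ∑ σ : 𝒮,
      C (size σ * (y (size σ) / (Nat.factorial (size σ) : ℝ))) * X ^ size σ := by
    rw [hS, weightedEgs, derivative_sum, Finset.mul_sum]
    refine Finset.sum_congr rfl fun σ _ => ?_
    rw [derivative_monomial, X_mul_monomial, Nat.sub_add_cancel (hpos σ), C_mul_X_pow_eq_monomial,
      mul_comm]
  have h3 : (PowerSeries.X * PowerSeries.derivative ℝ (expSeries S)) =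
      ∑ σ : 𝒮, expSeries S * (PowerSeries.C (size σ * (y (size σ) / (Nat.factorial (size σ) : ℝ)))
        * PowerSeries.X ^ size σ) := by
    rw [hd, mul_left_comm, ← Polynomial.coe_X, ← Polynomial.coe_mul, h2, ← Finset.mul_sum]
    congr 1
    rw [← Polynomial.coeToPowerSeries.ringHom_apply, map_sum]
    refine Finset.sum_congr rfl fun σ _ => ?_
    rw [Polynomial.coeToPowerSeries.ringHom_apply, Polynomial.coe_mul, Polynomial.coe_C,
      Polynomial.coe_pow, Polynomial.coe_X]
  rw [h1, h3, map_sum]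
  refine Finset.sum_congr rfl fun σ _ => ?_
  rw [← mul_assoc, PowerSeries.coeff_mul_X_pow', mul_comm (expSeries S)]
  split_ifs
  · rw [PowerSeries.coeff_C_mul]
  · rfl

variable {V : Type*} [Fintype V] [DecidableEq V] [DecidableEq 𝒮]

/-- The exponential formula for weighted sets of structures. -/
theorem weightedCount_eq {size : 𝒮 → ℕ} (hpos : ∀ σ, 0 < size σ) (y : ℕ → ℝ) (A : Finset V) :
    weightedCount size y A =
      A.card.factorial * PowerSeries.coeff A.card (expSeries (weightedEgs size y)) := by
  induction A using Finset.strongInduction with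
  | H A ih =>
  rcases A.eq_empty_or_nonempty with rfl | hA
  · simp only [Finset.card_empty]
    rw [weightedCount_empty hpos, coeff_zero_expSeries (coeff_weightedEgs_zero hpos y)]
    simp
  have hc : (A.card : ℝ) ≠ 0 := by exact_mod_cast (Finset.card_pos.2 hA).ne'
  -- After multiplication by |A|, both sides satisfy the same recursion; the binomial number of
  -- choices of B converts the factorials.
  refine mul_left_cancel₀ hc ?_
  rw [card_mul_weightedCount hpos, mul_left_comm, natCast_mul_coeff_expSeries hpos, Finset.mul_sum]
  refine Finset.sum_congr rfl fun σ _ => ?_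
  have h1 : ∀ B ∈ A.powersetCard (size σ), (size σ * y (size σ)) * weightedCount size y (A \ B) =
      (size σ * y (size σ)) * ((A.card - size σ).factorial *
        PowerSeries.coeff (A.card - size σ) (expSeries (weightedEgs size y))) := by
    intro B hB
    obtain ⟨hBA, hBc⟩ := Finset.mem_powersetCard.1 hB
    have hBne : B.Nonempty := Finset.card_pos.1 (hBc ▸ hpos σ)
    rw [ih (A \ B) (Finset.sdiff_ssubset hBA hBne), Finset.card_sdiff_of_subset hBA, hBc]
  rw [Finset.sum_congr rfl h1, Finset.sum_const, Finset.card_powersetCard, nsmul_eq_mul]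
  split_ifs with h
  · rw [← Nat.choose_mul_factorial_mul_factorial h]
    push_cast
    field_simp
  · rw [Nat.choose_eq_zero_of_lt (by omega)]
    simp

end

/-! ### Mean and tails of the number of components -/

section
variable {𝒮 : Type*} {size : 𝒮 → ℕ}

theorem SetStructure.isSetStructureOn {n : ℕ} (α : SetStructure size n) :
    IsSetStructureOn size Finset.univ α.components where
  card_eq := α.card_eq
  disjoint := α.disjoint
  biUnion_eq := by
    ext i
    simpa using α.cover i

theorem SetStructure.numComponents_eq {n : ℕ} (α : SetStructure size n) (t : ℕ) :
    α.numComponents t = (α.components.filter fun c => size c.2 = t).card := by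
  rw [SetStructure.numComponents]
  congr 1
  exact Finset.filter_congr fun c hc => by rw [α.card_eq c hc]

variable [Fintype 𝒮]

theorem egs_eq_weightedEgs (size : 𝒮 → ℕ) : egs size = weightedEgs size fun _ => 1 := rfl

theorem coeff_weightedEgs (size : 𝒮 → ℕ) (y : ℕ → ℝ) (i : ℕ) :
    (weightedEgs size y).coeff i = y i * (egs size).coeff i := by
  rw [egs, weightedEgs, finsetSum_coeff, finsetSum_coeff, Finset.mul_sum]
  refine Finset.sum_congr rfl fun σ _ => ?_
  rw [coeff_monomial, coeff_monomial]
  split_ifs with h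
  · rw [h]; ring
  · ring

theorem scaleCoeff_egs (size : 𝒮 → ℕ) (t : ℕ) (w : ℝ) :
    (egs size).scaleCoeff t w = weightedEgs size fun k => if k = t then w else 1 := by
  ext i
  rw [Polynomial.coeff_scaleCoeff, coeff_weightedEgs]

theorem coeff_egs_nonneg (size : 𝒮 → ℕ) (i : ℕ) : 0 ≤ (egs size).coeff i := by
  rw [egs, finsetSum_coeff]
  refine Finset.sum_nonneg fun σ _ => ?_
  rw [coeff_monomial]
  split_ifs <;> positivity

theorem coeff_egs_size_pos (σ : 𝒮) : 0 < (egs size).coeff (size σ) := by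
  rw [egs, finsetSum_coeff]
  refine Finset.sum_pos' (fun τ _ => ?_) ⟨σ, Finset.mem_univ _, ?_⟩
  · rw [coeff_monomial]
    split_ifs <;> positivity
  · rw [coeff_monomial, if_pos rfl]
    positivity

noncomputable instance SetStructure.instFintype (size : 𝒮 → ℕ) (n : ℕ) :
    Fintype (SetStructure size n) := Fintype.ofFinite _

instance SetStructure.instDiscreteMeasurableSpace (size : 𝒮 → ℕ) (n : ℕ) :
    DiscreteMeasurableSpace (SetStructure size n) := ⟨fun _ => trivial⟩

theorem SetStructure.sum_components {n : ℕ} (g : Finset (Finset (Fin n) × 𝒮) → ℝ) :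
    ∑ α : SetStructure size n, g α.components =
      ∑ P ∈ setStructuresOn size (Finset.univ : Finset (Fin n)), g P := by
  refine Finset.sum_bij (fun α _ => α.components)
    (fun α _ => mem_setStructuresOn.2 α.isSetStructureOn) (fun α _ β _ h => SetStructure.ext h)
    (fun P hP => ?_) (fun _ _ => rfl)
  have h := mem_setStructuresOn.1 hP
  exact ⟨⟨P, h.card_eq, h.disjoint, fun i => by
    have : i ∈ P.biUnion Prod.fst := h.biUnion_eq ▸ Finset.mem_univ i
    simpa using this⟩, Finset.mem_univ _, rfl⟩

/-- Giving weight w to components of size t and 1 to all others makes the product of weights equal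
to w to the number of marked-size components. -/
theorem SetStructure.sum_pow_numComponents (hpos : ∀ σ, 0 < size σ) (n t : ℕ) (w : ℝ) :
    ∑ α : SetStructure size n, w ^ α.numComponents t =
      n.factorial * PowerSeries.coeff n (expSeries ((egs size).scaleCoeff t w)) := by
  classical
  have h := weightedCount_eq hpos (fun k => if k = t then w else 1) (Finset.univ : Finset (Fin n))
  rw [Finset.card_univ, Fintype.card_fin, ← scaleCoeff_egs, weightedCount,
    ← SetStructure.sum_components (fun P => ∏ c ∈ P, if size c.2 = t then w else 1)] at h
  rw [← h]
  refine Finset.sum_congr rfl fun α _ => ?_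
  rw [SetStructure.numComponents_eq, Finset.prod_ite, Finset.prod_const, Finset.prod_const_one,
    mul_one]

theorem SetStructure.card_eq_coeff (hpos : ∀ σ, 0 < size σ) (n : ℕ) :
    (Fintype.card (SetStructure size n) : ℝ) =
      n.factorial * PowerSeries.coeff n (expSeries (egs size)) := by
  have h := SetStructure.sum_pow_numComponents hpos n 0 1
  have e : (egs size).scaleCoeff 0 1 = egs size := by simp [Polynomial.scaleCoeff]
  simpa [e] using h

/-- Counting pairs of a set structure and one of its components of size t: removing that component
leaves an unweighted set structure on n - t labels. -/
theorem SetStructure.sum_numComponents (hpos : ∀ σ, 0 < size σ) {n t : ℕ} (ht : t ≤ n) :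
    ∑ α : SetStructure size n, (α.numComponents t : ℝ) = n.factorial *
      ((egs size).coeff t * PowerSeries.coeff (n - t) (expSeries (egs size))) := by
  classical
  have h := sum_marked_component hpos (fun k => if k = t then 1 else 0) (fun _ => 1)
    (Finset.univ : Finset (Fin n))
  simp only [Finset.prod_const_one, mul_one] at h
  rw [← SetStructure.sum_components
    (fun P => ∑ c ∈ P, if size c.2 = t then (1 : ℝ) else 0)] at h
  have h1 : ∑ α : SetStructure size n, (α.numComponents t : ℝ) =
      ∑ α : SetStructure size n, ∑ c ∈ α.components, if size c.2 = t then (1 : ℝ) else 0 :=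
    Finset.sum_congr rfl fun α _ => by
      rw [SetStructure.numComponents_eq, Finset.sum_boole]
  rw [h1, h, egs, finsetSum_coeff, Finset.sum_mul, Finset.mul_sum]
  refine Finset.sum_congr rfl fun σ _ => ?_
  rw [coeff_monomial]
  split_ifs with hσ
  · have h2 : ∀ B ∈ (Finset.univ : Finset (Fin n)).powersetCard (size σ),
        1 * weightedCount size (fun _ => 1) (Finset.univ \ B) =
        (n - t).factorial * PowerSeries.coeff (n - t) (expSeries (egs size)) := by
      intro B hB
      obtain ⟨hBA, hBc⟩ := Finset.mem_powersetCard.1 hB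
      rw [one_mul, weightedCount_eq hpos, Finset.card_sdiff_of_subset hBA, hBc, hσ,
        Finset.card_univ, Fintype.card_fin, ← egs_eq_weightedEgs]
    rw [Finset.sum_congr rfl h2, Finset.sum_const, Finset.card_powersetCard, nsmul_eq_mul,
      Finset.card_univ, Fintype.card_fin, hσ, ← Nat.choose_mul_factorial_mul_factorial ht]
    push_cast
    rw [← egs]
    field_simp
  · simp

theorem integral_uniformLaw {n : ℕ} (f : SetStructure size n → ℝ) :
    ∫ α, f α ∂(uniformLaw size n) =
      (∑ α, f α) / (Fintype.card (SetStructure size n) : ℝ) := by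
  rcases isEmpty_or_nonempty (SetStructure size n) with h | h
  -- Without structures of size n the law is the zero measure, and the right-hand side is 0/0 = 0.
  · simp [MeasureTheory.Measure.eq_zero_of_isEmpty]
  have : MeasureTheory.IsProbabilityMeasure (uniformLaw size n) :=
    instIsProbabilityMeasure_uniformOn_univ
  rw [MeasureTheory.integral_fintype .of_finite, Finset.sum_div]
  refine Finset.sum_congr rfl fun α _ => ?_
  rw [uniformLaw, MeasureTheory.measureReal_def, uniformOn_univ, MeasureTheory.Measure.count_singleton]
  simp [div_eq_inv_mul]

theorem expectedComponents_eq (hpos : ∀ σ, 0 < size σ) {n t : ℕ} (ht : t ≤ n) :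
    expectedComponents size t n = (egs size).coeff t *
      (PowerSeries.coeff (n - t) (expSeries (egs size)) /
        PowerSeries.coeff n (expSeries (egs size))) := by
  rw [expectedComponents, integral_uniformLaw, SetStructure.sum_numComponents hpos ht,
    SetStructure.card_eq_coeff hpos, mul_div_mul_left _ _ (by positivity), mul_div_assoc]

theorem integral_pow_numComponents (hpos : ∀ σ, 0 < size σ) (n t : ℕ) (w : ℝ) :
    ∫ α, w ^ α.numComponents t ∂(uniformLaw size n) =
      PowerSeries.coeff n (expSeries ((egs size).scaleCoeff t w)) /
        PowerSeries.coeff n (expSeries (egs size)) := by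
  rw [integral_uniformLaw, SetStructure.sum_pow_numComponents hpos,
    SetStructure.card_eq_coeff hpos, mul_div_mul_left _ _ (by positivity)]

theorem coeff_egs_zero (hpos : ∀ σ, 0 < size σ) : (egs size).coeff 0 = 0 :=
  coeff_weightedEgs_zero hpos fun _ => 1

theorem isEquivalent_expectedComponents (hpos : ∀ σ, 0 < size σ) (hS : AperiodicPoly (egs size))
    (σ : 𝒮) :
    (fun n : ℕ => expectedComponents size (size σ) n) ~[atTop] fun n : ℕ =>
      ((egs size).coeff (size σ) * ((egs size).natDegree * (egs size).coeff (egs size).natDegree) ^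
        (-((size σ : ℝ) / (egs size).natDegree))) *
          (n : ℝ) ^ ((size σ : ℝ) / (egs size).natDegree) := by
  have hs := coeff_egs_size_pos (size := size) σ
  have hd : (0 : ℝ) < (egs size).natDegree := by exact_mod_cast hS.natDegree_pos
  have hsd := hS.coeff_natDegree_pos (coeff_egs_nonneg size)
  set K : ℝ := ((egs size).natDegree * (egs size).coeff (egs size).natDegree) ^
        (-((size σ : ℝ) / (egs size).natDegree)) with hK
  have hKpos : 0 < K := Real.rpow_pos_of_pos (by positivity) _
  refine isEquivalent_of_tendsto_one ?_
  have h := (tendsto_coeff_expSeries_ratio (coeff_egs_zero hpos) (coeff_egs_nonneg size) hS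
    (size σ)).div_const K
  rw [← hK, div_self hKpos.ne'] at h
  refine h.congr' ?_
  filter_upwards [eventually_ge_atTop (size σ)] with n hn
  rw [Pi.div_apply, expectedComponents_eq hpos hn, mul_assoc, mul_div_mul_left _ _ hs.ne',
    div_div, mul_comm K]

/-- Markov's inequality for w^χ_n. Phrasing the event through powers of w treats both tails at once:
w > 1 gives the upper tail, w < 1 the lower. -/
theorem exists_eventually_pow_numComponents_tail (hpos : ∀ σ, 0 < size σ)
    (hS : AperiodicPoly (egs size)) {t : ℕ} (ht : 0 < t) {w x : ℝ} (hw : 0 < w)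
    (hx : (w - 1) * ((egs size).coeff t *
      ((egs size).natDegree * (egs size).coeff (egs size).natDegree) ^
        (-((t : ℝ) / (egs size).natDegree))) < x * Real.log w) :
    ∃ γ : ℝ, 0 < γ ∧ γ < 1 ∧ ∀ᶠ n : ℕ in atTop,
      (uniformLaw size n).real {α | w ^ (x * (n : ℝ) ^ ((t : ℝ) / (egs size).natDegree)) ≤
        w ^ α.numComponents t} ≤ γ ^ ((n : ℝ) ^ ((t : ℝ) / (egs size).natDegree)) := by
  obtain ⟨y, hy1, hy2⟩ := exists_between hx
  refine ⟨Real.exp (y - x * Real.log w), Real.exp_pos _, Real.exp_lt_one_iff.2 (by linarith), ?_⟩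
  filter_upwards [eventually_coeff_expSeries_scaleCoeff_le (coeff_egs_zero hpos)
    (coeff_egs_nonneg size) hS ht hw.le hy1,
    eventually_coeff_expSeries_pos (coeff_egs_zero hpos) (coeff_egs_nonneg size) hS] with n h1 h2
  have hcard : (0 : ℝ) < Fintype.card (SetStructure size n) := by
    rw [SetStructure.card_eq_coeff hpos]
    positivity
  have : Nonempty (SetStructure size n) := Fintype.card_pos_iff.1 (by exact_mod_cast hcard)
  have : MeasureTheory.IsProbabilityMeasure (uniformLaw size n) :=
    instIsProbabilityMeasure_uniformOn_univ
  set N := (n : ℝ) ^ ((t : ℝ) / (egs size).natDegree)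
  have hM := MeasureTheory.mul_meas_ge_le_integral_of_nonneg (μ := uniformLaw size n)
    (f := fun α => w ^ α.numComponents t) (.of_forall fun α => by positivity) .of_finite
    (w ^ (x * N))
  rw [integral_pow_numComponents hpos] at hM
  have hwx : 0 < w ^ (x * N) := Real.rpow_pos_of_pos hw _
  rw [← mul_le_mul_iff_right₀ hwx]
  refine hM.trans ?_
  rw [div_le_iff₀ h2]
  refine h1.trans (le_of_eq ?_)
  rw [← Real.exp_mul, Real.rpow_def_of_pos hw, ← Real.exp_add, mul_comm]
  congr 2
  ring

theorem exponentialTails (hpos : ∀ σ, 0 < size σ) (hS : AperiodicPoly (egs size)) (σ : 𝒮)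
    {lam mu : ℝ} (h0 : 0 < lam)
    (hlam : lam < (egs size).coeff (size σ) *
      ((egs size).natDegree * (egs size).coeff (egs size).natDegree) ^
        (-((size σ : ℝ) / (egs size).natDegree)))
    (hmu : (egs size).coeff (size σ) *
      ((egs size).natDegree * (egs size).coeff (egs size).natDegree) ^
        (-((size σ : ℝ) / (egs size).natDegree)) < mu) :
    ExponentialTails size (size σ) ((size σ : ℝ) / (egs size).natDegree) lam mu := by
  set c := (egs size).coeff (size σ) *
      ((egs size).natDegree * (egs size).coeff (egs size).natDegree) ^
        (-((size σ : ℝ) / (egs size).natDegree)) with hc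
  have hcpos : 0 < c := h0.trans hlam
  -- By log w ≥ 1 - 1/w, it is enough that w lies strictly between 1 and x/c; the optimal choice w =
  -- x/c is not needed.
  have key : ∀ w x : ℝ, 0 < w → 0 < x → 0 < (w - 1) * (x - c * w) →
      (w - 1) * c < x * Real.log w := by
    intro w x hw hx h
    have h1 := mul_le_mul_of_nonneg_left (Real.one_sub_inv_le_log_of_pos hw) hx.le
    refine lt_of_lt_of_le ?_ h1
    rw [← sub_pos]
    have : x * (1 - w⁻¹) - (w - 1) * c = (w - 1) * (x - c * w) / w := by field_simp
    rw [this]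
    exact div_pos h hw
  obtain ⟨w₁, hw₁, hw₁'⟩ := exists_between ((div_lt_one hcpos).2 hlam)
  obtain ⟨w₂, hw₂, hw₂'⟩ := exists_between ((one_lt_div hcpos).2 hmu)
  have hw₁0 : 0 < w₁ := (div_pos h0 hcpos).trans hw₁
  have hw₂0 : 0 < w₂ := one_pos.trans hw₂
  rw [div_lt_iff₀ hcpos] at hw₁
  rw [lt_div_iff₀ hcpos] at hw₂'
  obtain ⟨γ₁, hγ₁, hγ₁', H₁⟩ := exists_eventually_pow_numComponents_tail hpos hS (hpos σ) hw₁0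
    (key w₁ lam hw₁0 h0 (mul_pos_of_neg_of_neg (by linarith) (by linarith)))
  obtain ⟨γ₂, hγ₂, hγ₂', H₂⟩ := exists_eventually_pow_numComponents_tail hpos hS (hpos σ) hw₂0
    (key w₂ mu hw₂0 (hcpos.trans hmu) (mul_pos (by linarith) (by linarith)))
  have hfin : ∀ n, MeasureTheory.IsFiniteMeasure (uniformLaw size n) := fun n => by
    rcases isEmpty_or_nonempty (SetStructure size n) with h | h
    · exact ⟨by simp [Set.univ_eq_empty_iff.2 h]⟩
    · have : MeasureTheory.IsProbabilityMeasure (uniformLaw size n) :=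
        instIsProbabilityMeasure_uniformOn_univ
      infer_instance
  have hbig : ∀ {γ : ℝ} {f : ℕ → ℝ}, 0 < γ → γ ≤ max γ₁ γ₂ → (∀ n, 0 ≤ f n) →
      (∀ᶠ n : ℕ in atTop, f n ≤ γ ^ ((n : ℝ) ^ ((size σ : ℝ) / (egs size).natDegree))) →
      f =O[atTop] fun n : ℕ =>
        (max γ₁ γ₂) ^ ((n : ℝ) ^ ((size σ : ℝ) / (egs size).natDegree)) := by
    intro γ f h1 h2 h3 h4
    refine IsBigO.of_bound 1 ?_
    filter_upwards [h4] with n hn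
    rw [one_mul, Real.norm_of_nonneg (h3 n), Real.norm_of_nonneg (Real.rpow_nonneg
      (h1.le.trans h2) _)]
    exact hn.trans (Real.rpow_le_rpow h1.le h2 (by positivity))
  -- `ExponentialTails` asks for a single γ, so the larger base is used for both tails.
  refine ⟨max γ₁ γ₂, lt_max_of_lt_left hγ₁, max_lt hγ₁' hγ₂', hbig hγ₁ (le_max_left _ _)
    (fun n => MeasureTheory.measureReal_nonneg) (H₁.mono fun n hn => ?_), hbig hγ₂ (le_max_right _ _)
    (fun n => MeasureTheory.measureReal_nonneg) (H₂.mono fun n hn => ?_)⟩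
  · have := hfin n
    refine le_trans (MeasureTheory.measureReal_mono fun α hα => ?_) hn
    rw [Set.mem_ofPred_eq, ← Real.rpow_natCast]
    exact Real.rpow_le_rpow_of_exponent_ge hw₁0 hw₁'.le hα
  · have := hfin n
    refine le_trans (MeasureTheory.measureReal_mono fun α hα => ?_) hn
    rw [Set.mem_ofPred_eq, ← Real.rpow_natCast]
    exact Real.rpow_le_rpow_of_exponent_le hw₂.le hα

end

theorem mainTheorem11 :
    (∀ (S : ℝ[X]) (d : ℕ), S.natDegree = d → S.coeff 0 = 0 → (∀ i, 0 ≤ S.coeff i) →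
      AperiodicPoly S →
      ∃ T : ℝ[X], T.natDegree ≤ d - 1 ∧
        (fun n : ℕ => PowerSeries.coeff n (expSeries S)) ~[atTop]
          fun n : ℕ => 1 / Real.sqrt (2 * Real.pi * d * n) * (n : ℝ) ^ (-((n : ℝ) / d)) *
            Real.exp ((n : ℝ) / d * (1 + Real.log (d * S.coeff d)) +
              T.eval ((n : ℝ) ^ (1 / (d : ℝ))))) ∧
    (∀ (𝒮 : Type*) [Fintype 𝒮] (size : 𝒮 → ℕ) (d t : ℕ) (c : ℝ),
      (∀ σ, 0 < size σ) → AperiodicPoly (egs size) → (egs size).natDegree = d →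
      (∃ σ, size σ = t) →
      c = (egs size).coeff t * (d * (egs size).coeff d) ^ (-((t : ℝ) / d)) →
      ((fun n : ℕ => expectedComponents size t n) ~[atTop]
        fun n : ℕ => c * (n : ℝ) ^ ((t : ℝ) / d)) ∧
      (∃ lam₀ mu₀ : ℝ, 0 < lam₀ ∧ lam₀ ≤ 1 ∧ 1 ≤ mu₀ ∧
        ∀ lam mu : ℝ, 0 < lam → lam < lam₀ → mu₀ < mu →
          ExponentialTails size t ((t : ℝ) / d) lam mu) ∧
      (∀ lam mu : ℝ, 0 < lam → lam < c → c < mu →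
        ExponentialTails size t ((t : ℝ) / d) lam mu)) := by
  refine ⟨?_, ?_⟩
  · rintro S d rfl h0 hn hS
    exact exists_isEquivalent_coeff_expSeries h0 hn hS
  · rintro 𝒮 _ size d t c hpos hS rfl ⟨σ, rfl⟩ hc
    have hd : (0 : ℝ) < (egs size).natDegree := by exact_mod_cast hS.natDegree_pos
    have hsd := hS.coeff_natDegree_pos (coeff_egs_nonneg size)
    have hc0 : 0 < c := by
      rw [hc]
      exact mul_pos (coeff_egs_size_pos σ) (Real.rpow_pos_of_pos (mul_pos hd hsd) _)
    have tails : ∀ lam mu : ℝ, 0 < lam → lam < c → c < mu →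
        ExponentialTails size (size σ) ((size σ : ℝ) / (egs size).natDegree) lam mu :=
      fun lam mu h0 hlam hmu =>
        exponentialTails hpos hS σ h0 (hlam.trans_eq hc) (hc.symm.trans_lt hmu)
    refine ⟨hc ▸ isEquivalent_expectedComponents hpos hS σ, ⟨min 1 c, max 1 c, lt_min one_pos hc0,
      min_le_left _ _, le_max_left _ _, fun lam mu h0 hlam hmu => ?_⟩, tails⟩
    exact tails lam mu h0 (hlam.trans_le (min_le_right _ _)) ((le_max_right _ _).trans_lt hmu)
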